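/- Let $X$ be a (real or complex) Banach space, let $K\subset X^*$ be a non-empty $w^*$-compact set, and let $1<p,q<\infty$ satisfy $1/p+1/q=1$. Let $L_p(X)=L_p([0,1];X)$ be the Bochner space over $[0,1]$ with Lebesgue measure, and $L_q$ the scalar space $L_q([0,1])$ with closed unit ball $B_{L_q}$. Let $K_p\subset L_p(X)^*$ denote the $w^*$-closure of the set of all functionals $$f\mapsto \int_0^1 \langle g(t),f(t)\rangle\, h(t)\,dt \qquad (f\in L_p(X)),$$ where $g:[0,1]\to K$ is a simple measurable function and $h\in B_{L_q}$. For a Banach space $Y$, a $w^*$-compact set $L\subset Y^*$ and $\varepsilon>0$, let $s_\varepsilon(L)$ be the set of all $y^*\in L$ such that $\operatorname{diam}(L\cap V)>\varepsilon$ (norm diameter) for every $w^*$-neighborhood $V$ of $y^*$. Put $s^0_\varepsilon(L)=L$, $s^{\zeta+1}_\varepsilon(L)=s_\varepsilon(s^\zeta_\varepsilon(L))$ and $s^\zeta_\varepsilon(L)=\bigcap_{\eta<\zeta}s^\eta_\varepsilon(L)$ for limit ordinals $\zeta$. Let $Sz(L,\varepsilon)$ be the least ordinal $\zeta$ with $s^\zeta_\varepsilon(L)=\varnothing$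 if there is one, and $Sz(L,\varepsilon)=\infty$ otherwise, and let $Sz(L)=\sup_{\varepsilon>0}Sz(L,\varepsilon)$. Here $\zeta<\infty$ for every ordinal $\zeta$, $\omega$ is the first infinite ordinal, sums, products and powers of ordinals are the usual ordinal operations, and $\omega\cdot\infty=\infty$. Then: 1. for every ordinal $\xi$, if $Sz(K)\le\omega^{\xi}$, then $Sz(K_p)\le\omega^{1+\xi}$; 2. if $K$ is convex, then $Sz(K_p)\le\omega\cdot Sz(K)$; 3. if $K$ is convex and $Sz(K)\ge\omega^{\omega}$, then $Sz(K_p)=Sz(K)$. -/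

import Mathlib

open MeasureTheory Topology
open scoped ENNReal Ordinal

universe u

/-- The derived set `s_ε(L)`: the points `x` of `L` such that `L ∩ V` has norm diameter `> ε`
for every weak-star neighbourhood `V` of `x`. -/
def szlenkDeriv {𝕜 : Type} [RCLike 𝕜] {X : Type u} [NormedAddCommGroup X] [NormedSpace 𝕜 X]
    (ε : ℝ) (L : Set (WeakDual 𝕜 X)) : Set (WeakDual 𝕜 X) :=
  {x | x ∈ L ∧ ∀ V ∈ 𝓝 x, ENNReal.ofReal ε < Metric.ediam (WeakDual.toStrongDual '' (L ∩ V))}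

/-- The transfinite derived sets: `s_ε^0(L) = L`, `s_ε^{ξ+1}(L) = s_ε(s_ε^ξ(L))`, and
`s_ε^ξ(L) = ⋂_{ζ < ξ} s_ε^ζ(L)` for a limit ordinal `ξ`. -/
noncomputable def szlenkIter {𝕜 : Type} [RCLike 𝕜] {X : Type u} [NormedAddCommGroup X]
    [NormedSpace 𝕜 X] (ε : ℝ) (L : Set (WeakDual 𝕜 X)) (ξ : Ordinal.{u}) :
    Set (WeakDual 𝕜 X) :=
  Ordinal.limitRecOn ξ L (fun _ S => szlenkDeriv ε S) (fun ξ _ S => ⋂ (ζ) (h : ζ < ξ), S ζ h)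

theorem szlenkIter_zero {𝕜 : Type} [RCLike 𝕜] {X : Type u} [NormedAddCommGroup X]
    [NormedSpace 𝕜 X] (ε : ℝ) (L : Set (WeakDual 𝕜 X)) : szlenkIter ε L 0 = L :=
  Ordinal.limitRecOn_zero ..

theorem szlenkIter_add_one {𝕜 : Type} [RCLike 𝕜] {X : Type u} [NormedAddCommGroup X]
    [NormedSpace 𝕜 X] (ε : ℝ) (L : Set (WeakDual 𝕜 X)) (ξ : Ordinal.{u}) :
    szlenkIter ε L (ξ + 1) = szlenkDeriv ε (szlenkIter ε L ξ) :=
  Ordinal.limitRecOn_add_one ..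

theorem szlenkIter_limit {𝕜 : Type} [RCLike 𝕜] {X : Type u} [NormedAddCommGroup X]
    [NormedSpace 𝕜 X] (ε : ℝ) (L : Set (WeakDual 𝕜 X)) {ξ : Ordinal.{u}}
    (hξ : Order.IsSuccLimit ξ) :
    szlenkIter ε L ξ = ⋂ (ζ) (_ : ζ < ξ), szlenkIter ε L ζ :=
  Ordinal.limitRecOn_limit _ _ _ _ hξ

/-- `Sz(L, ε)`: the least ordinal `ξ` with `s_ε^ξ(L) = ∅`, and `⊤` (that is, `∞`) if there is
none. -/
noncomputable def szlenkIndexAt {𝕜 : Type} [RCLike 𝕜] {X : Type u} [NormedAddCommGroup X]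
    [NormedSpace 𝕜 X] (ε : ℝ) (L : Set (WeakDual 𝕜 X)) : WithTop Ordinal.{u} :=
  ⨅ (ξ : Ordinal.{u}) (_ : szlenkIter ε L ξ = ∅), (ξ : WithTop Ordinal.{u})

/-- The Szlenk index `Sz(L) = sup_{ε > 0} Sz(L, ε)`. -/
noncomputable def szlenkIndex {𝕜 : Type} [RCLike 𝕜] {X : Type u} [NormedAddCommGroup X]
    [NormedSpace 𝕜 X] (L : Set (WeakDual 𝕜 X)) : WithTop Ordinal.{u} :=
  ⨆ (ε : ℝ) (_ : 0 < ε), szlenkIndexAt ε L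

/-- The functionals `f ↦ ∫₀¹ ⟨g(t), f(t)⟩ h(t) dt` on `L_p(X) = L_p([0,1]; X)`, where `g` is a
simple measurable function with values in `K` and `h` lies in the closed unit ball of
`L_q = L_q([0,1])`. -/
def simpleProducts {𝕜 : Type} [RCLike 𝕜] {X : Type u} [NormedAddCommGroup X] [NormedSpace 𝕜 X]
    (p q : ℝ≥0∞) [Fact (1 ≤ p)] (K : Set (WeakDual 𝕜 X)) :
    Set (WeakDual 𝕜 (Lp X p (volume : Measure unitInterval))) :=
  {φ | ∃ (g : SimpleFunc unitInterval (WeakDual 𝕜 X))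
      (h : Lp 𝕜 q (volume : Measure unitInterval)),
      (∀ t, g t ∈ K) ∧ ‖h‖ ≤ 1 ∧
      ∀ f : Lp X p (volume : Measure unitInterval), φ f = ∫ t, g t (f t) * h t}

/-- The set `K_p`: the weak-star closure of `simpleProducts p q K` in `L_p(X)^*`. -/
def lpSet {𝕜 : Type} [RCLike 𝕜] {X : Type u} [NormedAddCommGroup X] [NormedSpace 𝕜 X]
    (p q : ℝ≥0∞) [Fact (1 ≤ p)] (K : Set (WeakDual 𝕜 X)) :
    Set (WeakDual 𝕜 (Lp X p (volume : Measure unitInterval))) :=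
  closure (simpleProducts p q K)

/-!
The heart of the matter is the implication `Sz(K) ≤ ω ^ ξ → Sz(K_p) ≤ ω ^ (1 + ξ)`. The other two
claims follow from it. For convex `K` the index is a power of `ω` or `∞`
(`exists_szlenkIndex_eq_omega0_opow`), and `x ↦ (f ↦ x (∫ f))` embeds `K` into `K_p`
(`szlenkIndex_le_lpSet`).

Szlenk derivations are replaced by *ranks* (`FragRankLE`): an upper semicontinuous ordinal-valued
function such that points converging to `a` with the rank of `a` come within `ε` of `a`. Ranks are
local, combine lexicographically and pass to continuous images of compact spaces. So `K_p` can be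
replaced by the compact space of ultrafilters on the set of pairs `(g, h)`, which maps onto it.
There, the mass `∫_{g ∈ A} |h|^q` extends continuously for each `A ⊆ X^*`, which makes it possible
to speak of ultrafilters carrying all but `τ` of their mass near a compact set `F ⊆ K`
(`MassFamily.nearly`).

By induction on `ξ`, if `F` has rank at most `ω ^ ξ` for some `δ`, then these ultrafilters have rank
at most `ω ^ (1 + ξ)` for any `ε` larger than a constant depending on `δ` and `τ`
(`MassFamily.fragRankLE_nearly`). For `ξ > 0`, compactness gives a bound `ω ^ η * n` with `η < ξ` for
the rank of `F`, and one inducts on `n`. Let `F₁` be the part of `F` of rank at least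
`ω ^ η * (n - 1)`. The mass near `F₁`, rounded down to multiples of a small constant, is upper
semicontinuous with finitely many values. Near an ultrafilter, those with the same rounded mass have
almost no mass in `U \ F₁` for some open `U ⊇ F₁`, hence live near `F₁ ∪ (F \ U)`, a disjoint union
of compact sets of rank at most `ω ^ η * (n - 1)`. The tolerance `τ` absorbs the error, so that `δ`
stays fixed throughout. For `ξ = 0`, the set `F` has a finite `δ`-net, and the functional is
determined, up to a small error, by finitely many elements of the unit ball of `L_p^*`. Since `L_p`
is uniformly smooth, that ball has finite ranks (`IsUniformlySmooth.exists_rank`): the norm drops by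
a fixed amount whenever points stay `ε`-apart from their weak-star limit. These finite ranks are the
source of the extra factor `ω` (`fragRankLE_nearly_one`).
-/

/-! ### Fragmentation ranks -/

section FragRank

universe v w

variable {Y : Type w} [TopologicalSpace Y]

/-- `A` has `ε`-fragmentation rank at most `α` with respect to the distance function `d`: there is
a rank `ρ` with values below `α`, upper semicontinuous on `A`, such that the points of `A` close
to `a` with the same rank as `a` are at distance at most `ε` from `a`. No axioms of a metric are
asked of `d`. -/
def FragRankLE (d : Y → Y → ℝ) (ε : ℝ) (A : Set Y) (α : Ordinal.{v}) : Prop :=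
  ∃ ρ : Y → Ordinal.{v}, ∀ a ∈ A, ρ a < α ∧ ∀ᶠ y in 𝓝[A] a, ρ y ≤ ρ a ∧ (ρ y = ρ a → d y a ≤ ε)

namespace FragRankLE

variable {d : Y → Y → ℝ} {ε : ℝ} {A B : Set Y} {α β : Ordinal.{v}}

theorem mono (h : FragRankLE d ε A α) (hBA : B ⊆ A) (hαβ : α ≤ β) : FragRankLE d ε B β := by
  obtain ⟨ρ, hρ⟩ := h
  exact ⟨ρ, fun a ha => ⟨(hρ a (hBA ha)).1.trans_le hαβ,
    (hρ a (hBA ha)).2.filter_mono (nhdsWithin_mono a hBA)⟩⟩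

/-- The smallest value at `a` of a rank defined near `a` is itself a rank, so having fragmentation
rank at most `α` is a local property. -/
theorem of_local (h : ∀ a ∈ A, ∃ V, IsOpen V ∧ a ∈ V ∧ FragRankLE d ε (A ∩ V) α) :
    FragRankLE d ε A α := by
  obtain ⟨G, hG⟩ : ∃ G : Y → Set Ordinal.{v}, ∀ a γ, γ ∈ G a ↔ ∃ V, IsOpen V ∧ a ∈ V ∧
      ∃ ρ : Y → Ordinal.{v}, (∀ b ∈ A ∩ V, ρ b < α ∧
        ∀ᶠ y in 𝓝[A ∩ V] b, ρ y ≤ ρ b ∧ (ρ y = ρ b → d y b ≤ ε)) ∧ ρ a = γ :=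
    ⟨fun a => {γ | _}, fun _ _ => Iff.rfl⟩
  refine ⟨fun a => sInf (G a), fun a ha => ?_⟩
  have hne : (G a).Nonempty := by
    obtain ⟨V, hV, haV, ρ, hρ⟩ := h a ha
    exact ⟨ρ a, (hG _ _).2 ⟨V, hV, haV, ρ, hρ, rfl⟩⟩
  obtain ⟨V, hV, haV, ρ, hρ, hρa⟩ := (hG _ _).1 (csInf_mem hne)
  dsimp only
  rw [← hρa]
  obtain ⟨h1, h2⟩ := hρ a ⟨ha, haV⟩
  refine ⟨h1, ?_⟩
  rw [Set.inter_comm,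
    nhdsWithin_inter_of_mem (mem_nhdsWithin_of_mem_nhds (hV.mem_nhds haV))] at h2
  filter_upwards [h2, mem_nhdsWithin_of_mem_nhds (hV.mem_nhds haV)] with y hy hyV
  have hle : sInf (G y) ≤ ρ y := csInf_le' ((hG _ _).2 ⟨V, hV, hyV, ρ, hρ, rfl⟩)
  exact ⟨hle.trans hy.1, fun he => hy.2 (hy.1.antisymm (he ▸ hle))⟩

/-- If an upper semicontinuous function `Φ` with values below `N` has level sets which, locally,
have rank at most `α`, then the lexicographic rank shows that the whole set has rank at most
`α * N`. -/
theorem of_level {Φ : Y → ℕ} {N : ℕ}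
    (hΦ : ∀ a ∈ A, Φ a < N ∧ ∀ᶠ y in 𝓝[A] a, Φ y ≤ Φ a)
    (h : ∀ a ∈ A, ∃ V, IsOpen V ∧ a ∈ V ∧ FragRankLE d ε ({y ∈ A | Φ y = Φ a} ∩ V) α) :
    FragRankLE d ε A (α * N) := by
  have hlev : ∀ j : ℕ, FragRankLE d ε {y ∈ A | Φ y = j} α := by
    refine fun j => of_local ?_
    rintro a ⟨ha, rfl⟩
    exact h a ha
  choose ρ hρ using hlev
  have key : ∀ {i j : ℕ} {x y : Ordinal.{v}}, i < j → x < α → α * i + x < α * j + y := by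
    intro i j x y hij hx
    calc α * i + x < α * i + α := by gcongr
      _ = α * (i + 1 : ℕ) := by push_cast; rw [mul_add, mul_one]
      _ ≤ α * j := by gcongr; exact hij
      _ ≤ _ := le_self_add
  refine ⟨fun a => α * Φ a + ρ (Φ a) a, fun a ha => ⟨?_, ?_⟩⟩
  · have := key (y := 0) (hΦ a ha).1 (hρ (Φ a) a ⟨ha, rfl⟩).1
    simpa using this
  · have h2 := (hρ (Φ a) a ⟨ha, rfl⟩).2
    rw [eventually_nhdsWithin_iff] at h2
    filter_upwards [(hΦ a ha).2, self_mem_nhdsWithin, mem_nhdsWithin_of_mem_nhds h2]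
      with y hy hyA hy2
    rcases hy.lt_or_eq with hlt | heq
    · have := key (y := ρ (Φ a) a) hlt (hρ (Φ y) y ⟨hyA, rfl⟩).1
      exact ⟨this.le, fun he => absurd he this.ne⟩
    · obtain ⟨h3, h4⟩ := hy2 ⟨hyA, heq⟩
      rw [heq]
      exact ⟨by gcongr, fun he => h4 (by simpa using he)⟩

/-- An upper semicontinuous function on a compact set is bounded below any limit ordinal that
bounds its values. -/
theorem exists_lt (h : FragRankLE d ε A α) (hA : IsCompact A) (hα : Order.IsSuccLimit α) :
    ∃ β < α, FragRankLE d ε A β := by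
  obtain ⟨ρ, hρ⟩ := h
  rcases A.eq_empty_or_nonempty with rfl | hne
  · exact ⟨0, hα.bot_lt, ρ, by simp⟩
  have husc : UpperSemicontinuousOn ρ A := fun a ha c hc =>
    (hρ a ha).2.mono fun y hy => hy.1.trans_lt hc
  obtain ⟨a, ha, hmax⟩ := husc.exists_isMaxOn hne hA
  refine ⟨Order.succ (ρ a), hα.succ_lt (hρ a ha).1, ρ, fun b hb => ⟨?_, (hρ b hb).2⟩⟩
  exact Order.lt_succ_of_le (hmax hb)

/-- Ranks pass to continuous images of compact spaces: a point of the image is given the largest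
rank occurring in its fibre. -/
theorem range {Z : Type*} [TopologicalSpace Z] [T2Space Z] [CompactSpace Y] {π : Y → Z}
    (hπ : Continuous π) {dZ : Z → Z → ℝ}
    (h : FragRankLE (fun y a => dZ (π y) (π a)) ε Set.univ α) :
    FragRankLE dZ ε (Set.range π) α := by
  obtain ⟨ρ, hρ⟩ := h
  simp only [nhdsWithin_univ, Set.mem_univ, true_imp_iff] at hρ
  cases isEmpty_or_nonempty Y
  · exact ⟨fun _ => 0, by rintro _ ⟨a, rfl⟩; exact isEmptyElim a⟩
  have hmax : ∀ z ∈ Set.range π, ∃ a, π a = z ∧ ∀ b, π b = z → ρ b ≤ ρ a := by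
    rintro z ⟨a₀, rfl⟩
    have husc : UpperSemicontinuousOn ρ (π ⁻¹' {π a₀}) := fun a _ c hc =>
      ((hρ a).2.mono fun y hy => hy.1.trans_lt hc).filter_mono nhdsWithin_le_nhds
    obtain ⟨a, ha, hm⟩ := husc.exists_isMaxOn (Set.nonempty_of_mem (x := a₀) (s := π ⁻¹' {π a₀}) rfl)
      (isClosed_singleton.preimage hπ).isCompact
    exact ⟨a, ha, fun b hb => hm hb⟩
  choose! s hs hsmax using hmax
  refine ⟨fun z => ρ (s z), fun z hz => ⟨(hρ _).1, ?_⟩⟩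
  have hO : ∀ a, ∃ O, IsOpen O ∧ a ∈ O ∧
      ∀ y ∈ O, ρ y ≤ ρ a ∧ (ρ y = ρ a → dZ (π y) (π a) ≤ ε) := by
    intro a
    obtain ⟨O, h1, h2, h3⟩ := eventually_nhds_iff.1 (hρ a).2
    exact ⟨O, h2, h3, h1⟩
  choose O hOo haO hOρ using hO
  have hcl : IsClosed (π '' (⋃ a ∈ π ⁻¹' {z}, O a)ᶜ) :=
    ((isOpen_biUnion fun a _ => hOo a).isClosed_compl.isCompact.image hπ).isClosed
  have hz' : z ∉ π '' (⋃ a ∈ π ⁻¹' {z}, O a)ᶜ := by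
    rintro ⟨a, ha, haz⟩
    exact ha (Set.mem_biUnion (show a ∈ π ⁻¹' {z} from haz) (haO a))
  filter_upwards [mem_nhdsWithin_of_mem_nhds (hcl.isOpen_compl.mem_nhds hz'),
    self_mem_nhdsWithin] with z' hz1 hz2
  have hmem : s z' ∈ ⋃ a ∈ π ⁻¹' {z}, O a := by
    by_contra hcon
    exact hz1 ⟨s z', hcon, hs z' hz2⟩
  simp only [Set.mem_iUnion, Set.mem_preimage, Set.mem_singleton_iff, exists_prop] at hmem
  obtain ⟨a, haz, hmem⟩ := hmem
  obtain ⟨h1, h2⟩ := hOρ a _ hmem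
  have h3 := hsmax z hz a haz
  refine ⟨h1.trans h3, fun he => ?_⟩
  have h4 := h2 (h1.antisymm (he ▸ h3))
  rwa [hs z' hz2, haz] at h4

end FragRankLE

end FragRank

/-! ### Szlenk derivations and fragmentation ranks -/

section Szlenk

variable {𝕜 : Type} [RCLike 𝕜] {X : Type u} [NormedAddCommGroup X] [NormedSpace 𝕜 X]
  {Y : Type u} [NormedAddCommGroup Y] [NormedSpace 𝕜 Y]

/-- The norm distance of the dual, as a function on the dual with its weak-star topology. -/
noncomputable def dualDist (x y : WeakDual 𝕜 X) : ℝ :=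
  dist (WeakDual.toStrongDual x) (WeakDual.toStrongDual y)

theorem dualDist_nonneg (x y : WeakDual 𝕜 X) : 0 ≤ dualDist x y := dist_nonneg

theorem dualDist_le_iff {x y : WeakDual 𝕜 X} {c : ℝ} (hc : 0 ≤ c) :
    dualDist x y ≤ c ↔ ∀ v : X, ‖x v - y v‖ ≤ c * ‖v‖ := by
  rw [dualDist, dist_eq_norm, ContinuousLinearMap.opNorm_le_iff hc]
  rfl

theorem norm_sub_apply_le_dualDist (x y : WeakDual 𝕜 X) (v : X) :
    ‖x v - y v‖ ≤ dualDist x y * ‖v‖ :=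
  (dualDist_le_iff (dualDist_nonneg x y)).1 le_rfl v

theorem mem_szlenkDeriv_iff {ε : ℝ} (hε : 0 ≤ ε) {L : Set (WeakDual 𝕜 X)} {x : WeakDual 𝕜 X} :
    x ∈ szlenkDeriv ε L ↔
      x ∈ L ∧ ∀ V ∈ 𝓝 x, ∃ y ∈ L ∩ V, ∃ z ∈ L ∩ V, ε < dualDist y z := by
  refine and_congr_right fun _ => forall₂_congr fun V _ => ?_
  rw [← not_le, Metric.ediam_le_iff]
  simp only [Set.forall_mem_image, not_forall, not_le, edist_dist, exists_prop]
  simp only [ENNReal.ofReal_lt_ofReal_iff_of_nonneg hε, dualDist]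

theorem szlenkDeriv_subset (ε : ℝ) (L : Set (WeakDual 𝕜 X)) : szlenkDeriv ε L ⊆ L :=
  fun _ hx => hx.1

theorem isClosed_szlenkDeriv (ε : ℝ) {L : Set (WeakDual 𝕜 X)} (hL : IsClosed L) :
    IsClosed (szlenkDeriv ε L) := by
  have : szlenkDeriv ε L = L ∩ {x | ∀ V ∈ 𝓝 x,
      ENNReal.ofReal ε < Metric.ediam (WeakDual.toStrongDual '' (L ∩ V))} := rfl
  rw [this]
  refine hL.inter (isOpen_compl_iff.1 (isOpen_iff_mem_nhds.2 fun x hx => ?_))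
  simp only [Set.mem_compl_iff, Set.mem_ofPred_eq, not_forall] at hx
  obtain ⟨V, hV, hVx⟩ := hx
  filter_upwards [eventually_mem_nhds_iff.2 hV] with y hy hcon
  exact hVx (hcon V hy)

theorem szlenkIter_antitone (ε : ℝ) (L : Set (WeakDual 𝕜 X)) : Antitone (szlenkIter ε L) := by
  intro ξ ζ h
  induction ζ using Ordinal.limitRecOn with
  | zero => rw [nonpos_iff_eq_zero.1 h]
  | add_one ζ ih =>
    rcases h.lt_or_eq with h | rfl
    · rw [szlenkIter_add_one]
      exact (szlenkDeriv_subset _ _).trans (ih (Order.lt_add_one_iff.1 h))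
    · rfl
  | limit ζ hζ ih =>
    rcases h.lt_or_eq with h | rfl
    · rw [szlenkIter_limit _ _ hζ]
      exact Set.biInter_subset_of_mem h
    · rfl

theorem szlenkIter_subset (ε : ℝ) (L : Set (WeakDual 𝕜 X)) (ξ : Ordinal.{u}) :
    szlenkIter ε L ξ ⊆ L :=
  (szlenkIter_antitone ε L (zero_le (a := ξ))).trans_eq (szlenkIter_zero ε L)

theorem isClosed_szlenkIter (ε : ℝ) {L : Set (WeakDual 𝕜 X)} (hL : IsClosed L)
    (ξ : Ordinal.{u}) : IsClosed (szlenkIter ε L ξ) := by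
  induction ξ using Ordinal.limitRecOn with
  | zero => rwa [szlenkIter_zero]
  | add_one ζ ih => rw [szlenkIter_add_one]; exact isClosed_szlenkDeriv ε ih
  | limit ζ hζ ih =>
    rw [szlenkIter_limit _ _ hζ]
    exact isClosed_biInter ih

theorem fragRankLE_of_szlenkIter_eq_empty {ε : ℝ} (hε : 0 ≤ ε) {L : Set (WeakDual 𝕜 X)}
    (hL : IsClosed L) {α : Ordinal.{u}} (h : szlenkIter ε L α = ∅) :
    FragRankLE dualDist ε L α := by
  have hex : ∀ x ∈ L, ∃ ζ < α, x ∈ szlenkIter ε L ζ ∧ x ∉ szlenkIter ε L (ζ + 1) := by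
    intro x hx
    have hne : {ζ | x ∉ szlenkIter ε L ζ}.Nonempty := ⟨α, by simp [h]⟩
    have hmem : x ∉ szlenkIter ε L (sInf {ζ | x ∉ szlenkIter ε L ζ}) := csInf_mem hne
    have hle : sInf {ζ | x ∉ szlenkIter ε L ζ} ≤ α := csInf_le' (by simp [h])
    have hlt : ∀ ζ < sInf {ζ | x ∉ szlenkIter ε L ζ}, x ∈ szlenkIter ε L ζ := fun ζ hζ => by
      by_contra hcon
      exact notMem_of_lt_csInf' hζ hcon
    generalize sInf {ζ | x ∉ szlenkIter ε L ζ} = m at hmem hle hlt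
    induction m using Ordinal.limitRecOn with
    | zero => exact absurd (by rwa [szlenkIter_zero]) hmem
    | add_one ζ _ =>
      exact ⟨ζ, (Order.lt_add_one_iff.2 le_rfl).trans_le hle,
        hlt ζ (Order.lt_add_one_iff.2 le_rfl), hmem⟩
    | limit m hm _ =>
      rw [szlenkIter_limit _ _ hm] at hmem
      exact absurd (Set.mem_iInter₂.2 hlt) hmem
  choose! ρ hρα hρ hρ' using hex
  refine ⟨ρ, fun a ha => ⟨hρα a ha, ?_⟩⟩
  have hd : a ∉ szlenkDeriv ε (szlenkIter ε L (ρ a)) := by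
    rw [← szlenkIter_add_one]; exact hρ' a ha
  rw [mem_szlenkDeriv_iff hε] at hd
  simp only [hρ a ha, true_and, not_forall, not_exists, not_and, not_lt] at hd
  obtain ⟨V, hV, hVd⟩ := hd
  filter_upwards [self_mem_nhdsWithin, mem_nhdsWithin_of_mem_nhds hV, mem_nhdsWithin_of_mem_nhds
    ((isClosed_szlenkIter ε hL (ρ a + 1)).isOpen_compl.mem_nhds (hρ' a ha))] with y hyL hyV hy
  refine ⟨?_, fun he => hVd y ⟨he ▸ hρ y hyL, hyV⟩ a ⟨hρ a ha, mem_of_mem_nhds hV⟩⟩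
  by_contra! hcon
  exact hy (szlenkIter_antitone ε L (Order.add_one_le_of_lt hcon) (hρ y hyL))

theorem FragRankLE.szlenkIter_eq_empty {ε : ℝ} (hε : 0 ≤ ε) {L : Set (WeakDual 𝕜 X)}
    {α : Ordinal.{u}} (h : FragRankLE dualDist (ε / 2) L α) : szlenkIter ε L α = ∅ := by
  obtain ⟨ρ, hρ⟩ := h
  have key : ∀ ζ, ∀ x ∈ szlenkIter ε L ζ, ζ ≤ ρ x := by
    intro ζ
    induction ζ using Ordinal.limitRecOn with
    | zero => exact fun x _ => zero_le
    | add_one ζ ih =>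
      intro x hx
      rw [szlenkIter_add_one, mem_szlenkDeriv_iff hε] at hx
      refine Order.add_one_le_of_lt ((ih x hx.1).lt_of_ne fun he => ?_)
      obtain ⟨y, hy, z, hz, hyz⟩ :=
        hx.2 _ (eventually_nhdsWithin_iff.1 (hρ x (szlenkIter_subset _ _ _ hx.1)).2)
      have hnear : ∀ w ∈ szlenkIter ε L ζ ∩
          {w | w ∈ L → ρ w ≤ ρ x ∧ (ρ w = ρ x → dualDist w x ≤ ε / 2)},
          dualDist w x ≤ ε / 2 := fun w hw => by
        obtain ⟨h1, h2⟩ := hw.2 (szlenkIter_subset _ _ _ hw.1)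
        exact h2 (h1.antisymm (he ▸ ih w hw.1))
      have h1 := hnear y hy
      have h2 := hnear z hz
      have h3 := dist_triangle_right (WeakDual.toStrongDual y) (WeakDual.toStrongDual z)
        (WeakDual.toStrongDual x)
      simp only [dualDist] at h1 h2 hyz
      linarith
    | limit ζ hζ ih =>
      intro x hx
      rw [szlenkIter_limit _ _ hζ, Set.mem_iInter₂] at hx
      exact (Order.IsSuccLimit.le_iff_forall_le hζ).2 fun η hη => ih η hη x (hx η hη)
  refine Set.eq_empty_of_forall_notMem fun x hx => ?_
  exact ((hρ x (szlenkIter_subset _ _ _ hx)).1.trans_le (key α x hx)).false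

/-- Weak-star continuous maps that contract distances by at most the factor `c` carry the derived
sets for `ε` into those for `c * ε`. -/
theorem mapsTo_szlenkIter {A : Set (WeakDual 𝕜 X)} {B : Set (WeakDual 𝕜 Y)}
    {T : WeakDual 𝕜 X → WeakDual 𝕜 Y} (hT : Continuous T) (hAB : Set.MapsTo T A B) {c ε : ℝ}
    (hc : 0 < c) (hε : 0 ≤ ε) (hd : ∀ x y, c * dualDist x y ≤ dualDist (T x) (T y))
    (ξ : Ordinal.{u}) : Set.MapsTo T (szlenkIter ε A ξ) (szlenkIter (c * ε) B ξ) := by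
  induction ξ using Ordinal.limitRecOn with
  | zero => simpa only [szlenkIter_zero] using hAB
  | add_one ζ ih =>
    rw [szlenkIter_add_one, szlenkIter_add_one]
    intro x hx
    rw [mem_szlenkDeriv_iff hε] at hx
    rw [mem_szlenkDeriv_iff (by positivity)]
    refine ⟨ih hx.1, fun V hV => ?_⟩
    obtain ⟨y, hy, z, hz, hyz⟩ := hx.2 _ (hT.continuousAt hV)
    exact ⟨T y, ⟨ih hy.1, hy.2⟩, T z, ⟨ih hz.1, hz.2⟩,
      (mul_lt_mul_of_pos_left hyz hc).trans_le (hd y z)⟩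
  | limit ζ hζ ih =>
    rw [szlenkIter_limit _ _ hζ, szlenkIter_limit _ _ hζ]
    exact fun x hx => Set.mem_iInter₂.2 fun η hη => ih η hη (Set.mem_iInter₂.1 hx η hη)

theorem szlenkIter_szlenkIter (ε : ℝ) (L : Set (WeakDual 𝕜 X)) (ξ ζ : Ordinal.{u}) :
    szlenkIter ε (szlenkIter ε L ξ) ζ ⊆ szlenkIter ε L (ξ + ζ) := by
  induction ζ using Ordinal.limitRecOn with
  | zero => simp [szlenkIter_zero]
  | add_one ζ ih =>
    rw [← add_assoc, szlenkIter_add_one, szlenkIter_add_one]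
    refine fun x hx => ⟨ih hx.1, fun V hV => (hx.2 V hV).trans_le (Metric.ediam_mono ?_)⟩
    exact Set.image_mono (Set.inter_subset_inter_left V ih)
  | limit ζ hζ ih =>
    rw [szlenkIter_limit _ _ hζ, szlenkIter_limit _ _ (Ordinal.isSuccLimit_add ξ hζ)]
    intro x hx
    refine Set.mem_iInter₂.2 fun η hη => ?_
    rw [Set.mem_iInter₂] at hx
    rcases le_or_gt ξ η with h | h
    · obtain ⟨σ, rfl⟩ := exists_add_of_le h
      have hσ : σ < ζ := by simpa using hη
      exact ih σ hσ (hx σ hσ)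
    · have := hx 0 hζ.bot_lt
      rw [szlenkIter_zero] at this
      exact szlenkIter_antitone ε L h.le this

theorem szlenkIndexAt_le_iff {ε : ℝ} {L : Set (WeakDual 𝕜 X)} {α : Ordinal.{u}} :
    szlenkIndexAt ε L ≤ (α : WithTop Ordinal.{u}) ↔ szlenkIter ε L α = ∅ := by
  refine ⟨fun h => ?_, fun h => iInf₂_le α h⟩
  by_contra hne
  have : ((Order.succ α : Ordinal.{u}) : WithTop Ordinal.{u}) ≤ szlenkIndexAt ε L := by
    refine le_iInf₂ fun ζ hζ => WithTop.coe_le_coe.2 (Order.succ_le_of_lt ?_)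
    by_contra! hle
    exact hne (Set.subset_eq_empty (szlenkIter_antitone ε L hle) hζ)
  exact (Order.lt_succ α).not_ge (WithTop.coe_le_coe.1 (this.trans h))

theorem szlenkIndex_le_iff {L : Set (WeakDual 𝕜 X)} {α : Ordinal.{u}} :
    szlenkIndex L ≤ (α : WithTop Ordinal.{u}) ↔ ∀ ε : ℝ, 0 < ε → szlenkIter ε L α = ∅ := by
  simp only [szlenkIndex, iSup₂_le_iff, szlenkIndexAt_le_iff]

/-- The Szlenk index of a non-empty convex set is a power of `ω` or `∞`: if the derived set of
order `ζ` for `ε` contains `x`, then the one for `ε / 2` contains the copy `(x + K) / 2` of `K`,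
which can be derived another `ζ` times. -/
theorem exists_szlenkIndex_eq_omega0_opow {K : Set (WeakDual 𝕜 X)} (hK : Convex ℝ K)
    (hne : K.Nonempty) :
    szlenkIndex K = ⊤ ∨ ∃ ξ : Ordinal.{u}, szlenkIndex K = ((ω ^ ξ : Ordinal.{u}) : WithTop _) := by
  rcases eq_or_ne (szlenkIndex K) ⊤ with h | h
  · exact .inl h
  right
  obtain ⟨σ, hσ⟩ := WithTop.ne_top_iff_exists.1 h
  have hlt : ∀ ζ : Ordinal.{u}, ζ < σ ↔ ∃ ε : ℝ, 0 < ε ∧ (szlenkIter ε K ζ).Nonempty := by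
    intro ζ
    rw [← not_le, ← WithTop.coe_le_coe, hσ, szlenkIndex_le_iff]
    simp [Set.nonempty_iff_ne_empty]
  have hmid : ∀ x y : WeakDual 𝕜 X, x ∈ K → y ∈ K → (2⁻¹ : 𝕜) • (x + y) ∈ K := by
    intro x y hx hy
    have := hK hx hy (by norm_num : (0 : ℝ) ≤ 2⁻¹) (by norm_num : (0 : ℝ) ≤ 2⁻¹) (by norm_num)
    convert this using 1
    refine DFunLike.ext _ _ fun v => ?_
    change (2⁻¹ : 𝕜) * (x v + y v) = (2⁻¹ : ℝ) • x v + (2⁻¹ : ℝ) • y v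
    rw [RCLike.real_smul_eq_coe_mul, RCLike.real_smul_eq_coe_mul, mul_add,
      RCLike.ofReal_inv, RCLike.ofReal_ofNat]
  have hprin : Ordinal.IsPrincipal (· + ·) σ := by
    refine Ordinal.isPrincipal_add_iff_add_self_lt.2 fun ζ hζ => ?_
    obtain ⟨ε, hε, x, hx⟩ := (hlt ζ).1 hζ
    have hstep : ∀ x ∈ K, ∀ B, (∀ y ∈ K, (2⁻¹ : 𝕜) • (x + y) ∈ B) →
        ∀ y ∈ szlenkIter ε K ζ, (2⁻¹ : 𝕜) • (x + y) ∈ szlenkIter (2⁻¹ * ε) B ζ := by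
      intro x hx B hB
      refine mapsTo_szlenkIter (T := fun y => (2⁻¹ : 𝕜) • (x + y)) ?_ hB (by norm_num) hε.le ?_ ζ
      · fun_prop
      · intro y z
        rw [inv_mul_le_iff₀ two_pos, dualDist_le_iff (mul_nonneg two_pos.le (dualDist_nonneg _ _))]
        intro v
        have h := norm_sub_apply_le_dualDist ((2⁻¹ : 𝕜) • (x + y)) ((2⁻¹ : 𝕜) • (x + z)) v
        change ‖(2⁻¹ : 𝕜) * (x v + y v) - (2⁻¹ : 𝕜) * (x v + z v)‖ ≤ _ at h
        rw [← mul_sub, add_sub_add_left_eq_sub, norm_mul, norm_inv, RCLike.norm_ofNat,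
          inv_mul_le_iff₀ two_pos] at h
        linarith
    refine (hlt _).2 ⟨2⁻¹ * ε, by positivity, (2⁻¹ : 𝕜) • (x + x), ?_⟩
    have hxK := szlenkIter_subset _ _ _ hx
    refine szlenkIter_szlenkIter _ _ _ _ (hstep x hxK _ (fun y hy => ?_) x hx)
    rw [add_comm]
    exact hstep y hy K (fun z hz => hmid y z hy hz) x hx
  rcases Ordinal.isPrincipal_add_iff_zero_or_omega0_opow.1 hprin with h0 | ⟨ξ, hξ⟩
  · have : (0 : Ordinal.{u}) < σ := (hlt 0).2 ⟨1, one_pos, by rwa [szlenkIter_zero]⟩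
    exact absurd h0 this.ne'
  · exact ⟨ξ, by rw [← hσ, ← hξ]⟩

end Szlenk

/-! ### Uniform smoothness of the scalar `L_p` space -/

section Smooth

/-- The modulus of smoothness of `E` at some `t > 0` is at most `η * t`, for every `η > 0`. -/
def IsUniformlySmooth (𝕜 : Type*) [RCLike 𝕜] (E : Type*) [NormedAddCommGroup E]
    [NormedSpace 𝕜 E] : Prop :=
  ∀ η : ℝ, 0 < η → ∃ t : ℝ, 0 < t ∧ ∀ f g : E, ‖f‖ ≤ 1 → ‖g‖ ≤ 1 →
    ‖f + (t : 𝕜) • g‖ + ‖f - (t : 𝕜) • g‖ ≤ 2 + η * t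

theorem exists_norm_rpow_add_sub_le {E : Type*} [NormedAddCommGroup E] [InnerProductSpace ℝ E]
    [FiniteDimensional ℝ E] {p : ℝ} (hp : 1 < p) {η : ℝ} (hη : 0 < η) :
    ∃ t : ℝ, 0 < t ∧ ∀ a b : E, ‖a + t • b‖ ^ p + ‖a - t • b‖ ^ p ≤
      2 * ‖a‖ ^ p + η * t * (‖a‖ ^ p + ‖b‖ ^ p) := by
  have hC := contDiff_norm_rpow (E := E) hp
  have hcont := hC.continuous_fderiv one_ne_zero
  have huc := (isCompact_closedBall (0 : E) 2).uniformContinuousOn_of_continuous hcont.continuousOn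
  obtain ⟨δ, hδ, hδη⟩ := Metric.uniformContinuousOn_iff.1 huc η hη
  have hp0 : p ≠ 0 := by positivity
  obtain ⟨t, ht, ht1, htδ⟩ : ∃ t : ℝ, 0 < t ∧ t ≤ 1 ∧ 2 * t < δ :=
    ⟨min 1 (δ / 3), by positivity, min_le_left _ _, by have := min_le_right 1 (δ / 3); linarith⟩
  have key : ∀ a b : E, ‖a‖ ≤ 1 → ‖b‖ ≤ 1 →
      ‖a + t • b‖ ^ p + ‖a - t • b‖ ^ p ≤ 2 * ‖a‖ ^ p + η * t := by
    intro a b ha hb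
    have hder : ∀ s : ℝ, HasDerivAt (fun s : ℝ => ‖a + s • b‖ ^ p + ‖a - s • b‖ ^ p)
        ((fderiv ℝ (fun x : E => ‖x‖ ^ p) (a + s • b)) b +
          (fderiv ℝ (fun x : E => ‖x‖ ^ p) (a - s • b)) (-b)) s := by
      intro s
      have hd := hC.differentiable one_ne_zero
      have h1 : HasDerivAt (fun s : ℝ => a + s • b) b s := by
        simpa using ((hasDerivAt_id s).smul_const b).const_add a
      have h2 : HasDerivAt (fun s : ℝ => a - s • b) (-b) s := by
        simpa using ((hasDerivAt_id s).smul_const b).const_sub a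
      exact ((hd _).hasFDerivAt.comp_hasDerivAt s h1).add
        ((hd _).hasFDerivAt.comp_hasDerivAt s h2)
    have hmv := (convex_Icc (0 : ℝ) t).norm_image_sub_le_of_norm_hasDerivWithin_le (C := η)
      (fun s _ => (hder s).hasDerivWithinAt) (fun s hs => ?_)
      (Set.left_mem_Icc.2 ht.le) (Set.right_mem_Icc.2 ht.le)
    · simp only [zero_smul, add_zero, sub_zero, Real.norm_eq_abs, abs_of_pos ht] at hmv
      have := (abs_le.1 hmv).2
      linarith
    · have hsb : ‖s • b‖ ≤ t := by
        rw [norm_smul, Real.norm_eq_abs, abs_of_nonneg hs.1]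
        exact (mul_le_of_le_one_right hs.1 hb).trans hs.2
      have hmem1 : a + s • b ∈ Metric.closedBall (0 : E) 2 := by
        rw [mem_closedBall_zero_iff]
        linarith [norm_add_le a (s • b)]
      have hmem2 : a - s • b ∈ Metric.closedBall (0 : E) 2 := by
        rw [mem_closedBall_zero_iff]
        linarith [norm_sub_le a (s • b)]
      have hdist : dist (a + s • b) (a - s • b) < δ := by
        rw [dist_eq_norm, add_sub_sub_cancel]
        linarith [norm_add_le (s • b) (s • b)]
      have := hδη _ hmem1 _ hmem2 hdist
      rw [dist_eq_norm] at this
      rw [map_neg, ← sub_eq_add_neg, ← _root_.sub_apply]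
      exact (ContinuousLinearMap.le_of_opNorm_le_of_le _ this.le hb).trans (mul_one η).le
  refine ⟨t, ht, fun a b => ?_⟩
  -- Both sides are homogeneous of degree `p`, so it suffices to treat `max ‖a‖ ‖b‖ = 1`.
  obtain ⟨m, hm, ham, hbm, hmle⟩ : ∃ m : ℝ, 0 ≤ m ∧ ‖a‖ ≤ m ∧ ‖b‖ ≤ m ∧
      m ^ p ≤ ‖a‖ ^ p + ‖b‖ ^ p := by
    refine ⟨max ‖a‖ ‖b‖, by positivity, le_max_left _ _, le_max_right _ _, ?_⟩
    rcases max_choice ‖a‖ ‖b‖ with h | h <;> rw [h]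
    · exact le_add_of_nonneg_right (by positivity)
    · exact le_add_of_nonneg_left (by positivity)
  rcases hm.eq_or_lt with rfl | hm
  · have ha := norm_le_zero_iff.1 ham
    have hb := norm_le_zero_iff.1 hbm
    simp [ha, hb, hp0]
  have hscale : ∀ c : E, ‖c‖ ^ p = m ^ p * ‖m⁻¹ • c‖ ^ p := fun c => by
    rw [norm_smul, norm_inv, Real.norm_eq_abs, abs_of_pos hm,
      ← Real.mul_rpow hm.le (by positivity), mul_inv_cancel_left₀ hm.ne']
  have hball : ∀ c : E, ‖c‖ ≤ m → ‖m⁻¹ • c‖ ≤ 1 := fun c hc => by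
    rw [norm_smul, norm_inv, Real.norm_eq_abs, abs_of_pos hm, inv_mul_le_iff₀ hm, mul_one]
    exact hc
  have h := key (m⁻¹ • a) (m⁻¹ • b) (hball a ham) (hball b hbm)
  rw [hscale (a + t • b), hscale (a - t • b)]
  have h' := mul_le_mul_of_nonneg_left h (by positivity : (0 : ℝ) ≤ m ^ p)
  rw [mul_add, mul_add, mul_left_comm, ← hscale a] at h'
  rw [smul_add, smul_sub, smul_comm m⁻¹ t b]
  refine h'.trans (add_le_add le_rfl ?_)
  rw [mul_comm]
  gcongr

theorem Lp_norm_rpow_eq_integral {α : Type*} [MeasurableSpace α] {μ : Measure α} {E : Type*}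
    [NormedAddCommGroup E] {p : ℝ≥0∞} (hp0 : p ≠ 0) (hp : p ≠ ∞) (f : Lp E p μ) :
    ‖f‖ ^ p.toReal = ∫ x, ‖f x‖ ^ p.toReal ∂μ := by
  have hp' : 0 < p.toReal := ENNReal.toReal_pos hp0 hp
  rw [Lp.norm_def, (Lp.memLp f).eLpNorm_eq_integral_rpow_norm hp0 hp,
    ENNReal.toReal_ofReal (by positivity), Real.rpow_inv_rpow (by positivity) hp'.ne']

theorem isUniformlySmooth_Lp {𝕜 : Type*} [RCLike 𝕜] {α : Type*} [MeasurableSpace α]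
    (μ : Measure α) {p : ℝ≥0∞} [Fact (1 ≤ p)] (hp1 : 1 < p) (hp : p ≠ ∞) :
    IsUniformlySmooth 𝕜 (Lp 𝕜 p μ) := by
  intro η hη
  have hP : 1 < p.toReal := by
    rw [← ENNReal.toReal_one]
    exact (ENNReal.toReal_lt_toReal ENNReal.one_ne_top hp).2 hp1
  have hp0 : p ≠ 0 := (zero_lt_one.trans hp1).ne'
  obtain ⟨t, ht, key⟩ := exists_norm_rpow_add_sub_le (E := 𝕜) hP (half_pos hη)
  refine ⟨t, ht, fun f g hf hg => ?_⟩
  have hint : ∀ f : Lp 𝕜 p μ, Integrable (fun x => ‖f x‖ ^ p.toReal) μ := fun f =>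
    (Lp.memLp f).integrable_norm_rpow hp0 hp
  have hint2 : ∀ f g : Lp 𝕜 p μ,
      Integrable (fun x => ‖f x‖ ^ p.toReal + ‖g x‖ ^ p.toReal) μ := fun f g =>
    (hint f).add (hint g)
  have hsum : ‖f + (t : 𝕜) • g‖ ^ p.toReal + ‖f - (t : 𝕜) • g‖ ^ p.toReal ≤
      2 * ‖f‖ ^ p.toReal + η / 2 * t * (‖f‖ ^ p.toReal + ‖g‖ ^ p.toReal) := by
    simp only [Lp_norm_rpow_eq_integral hp0 hp]
    rw [← integral_add (hint _) (hint _), ← integral_add (hint _) (hint _),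
      ← integral_const_mul, ← integral_const_mul,
      ← integral_add ((hint _).const_mul _) ((hint2 _ _).const_mul _)]
    refine integral_mono_ae (hint2 _ _)
      (((hint _).const_mul _).add ((hint2 _ _).const_mul _)) ?_
    filter_upwards [Lp.coeFn_add f ((t : 𝕜) • g), Lp.coeFn_sub f ((t : 𝕜) • g),
      Lp.coeFn_smul (t : 𝕜) g] with x h1 h2 h3
    have := key (f x) (g x)
    simp only [h1, h2, Pi.add_apply, Pi.sub_apply, h3, Pi.smul_apply]
    rwa [RCLike.real_smul_eq_coe_smul (K := 𝕜)] at this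
  have hf1 := Real.rpow_le_one (norm_nonneg f) hf (zero_le_one.trans hP.le)
  have hg1 := Real.rpow_le_one (norm_nonneg g) hg (zero_le_one.trans hP.le)
  have hbern : ∀ u : ℝ, 0 ≤ u → 1 + p.toReal * (u - 1) ≤ u ^ p.toReal := fun u hu => by
    simpa using one_add_mul_self_le_rpow_one_add (s := u - 1) (by linarith) hP.le
  have h1 := hbern _ (norm_nonneg (f + (t : 𝕜) • g))
  have h2 := hbern _ (norm_nonneg (f - (t : 𝕜) • g))
  have h3 : η / 2 * t * (‖f‖ ^ p.toReal + ‖g‖ ^ p.toReal) ≤ η / 2 * t * 2 := by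
    gcongr; linarith
  have h4 : p.toReal * (‖f + (t : 𝕜) • g‖ + ‖f - (t : 𝕜) • g‖ - 2) ≤ η * t := by linarith
  by_contra! hcon
  have : 1 * (η * t) < p.toReal * (‖f + (t : 𝕜) • g‖ + ‖f - (t : 𝕜) • g‖ - 2) := by
    have : 0 < η * t := by positivity
    gcongr
    linarith
  linarith

theorem exists_re_apply_gt {𝕜 : Type*} [RCLike 𝕜] {E : Type*} [NormedAddCommGroup E]
    [NormedSpace 𝕜 E] (φ : StrongDual 𝕜 E) {r : ℝ} (hr : r < ‖φ‖) :
    ∃ f : E, ‖f‖ ≤ 1 ∧ r < RCLike.re (φ f) := by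
  obtain ⟨f, hf, hrf⟩ := φ.exists_lt_apply_of_lt_opNorm hr
  obtain ⟨c, hc, hcf⟩ := RCLike.exists_norm_eq_mul_self (φ f)
  refine ⟨c • f, by rw [norm_smul, hc, one_mul]; exact hf.le, ?_⟩
  rwa [map_smul, smul_eq_mul, ← hcf, RCLike.ofReal_re]

/-- In the dual of a uniformly smooth space the weak-star closed unit ball has finite
fragmentation ranks: when points tend weak-star to `x` and stay at distance `ε` from it, the norm
drops by a fixed amount `c` in the limit. -/
theorem IsUniformlySmooth.exists_rank {𝕜 : Type*} [RCLike 𝕜] {E : Type*} [NormedAddCommGroup E]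
    [NormedSpace 𝕜 E] (hE : IsUniformlySmooth 𝕜 E) {ε : ℝ} (hε : 0 < ε) :
    ∃ ρ : WeakDual 𝕜 E → ℕ, ∀ x : WeakDual 𝕜 E, ‖WeakDual.toStrongDual x‖ ≤ 1 →
      ∀ᶠ y in 𝓝 x, ‖WeakDual.toStrongDual y‖ ≤ 1 →
        ρ y ≤ ρ x ∧ (ρ y = ρ x → ∀ v, ‖y v - x v‖ ≤ ε * ‖v‖) := by
  obtain ⟨t, ht, hsm⟩ := hE (ε / 2) (half_pos hε)
  -- With this `c`, smoothness gives `‖y - x‖ ≤ 2 * c / t + ε / 2 = ε` when the norms of `x`, `y` and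
  -- `(x + y) / 2` lie in an interval of length `c`.
  have hc : 0 < t * ε / 4 := by positivity
  set c := t * ε / 4 with hcdef
  refine ⟨fun y => ⌊(1 - ‖WeakDual.toStrongDual y‖) / c⌋₊, fun x hx => ?_⟩
  have hfl : ∀ y : WeakDual 𝕜 E, ‖WeakDual.toStrongDual y‖ ≤ 1 → ∀ j : ℕ,
      (⌊(1 - ‖WeakDual.toStrongDual y‖) / c⌋₊ = j ↔
        ‖WeakDual.toStrongDual y‖ ≤ 1 - j * c ∧ 1 - (j + 1) * c < ‖WeakDual.toStrongDual y‖) := by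
    intro y hy j
    rw [Nat.floor_eq_iff (div_nonneg (by linarith) hc.le), le_div_iff₀ hc, div_lt_iff₀ hc]
    constructor <;> rintro ⟨h1, h2⟩ <;> constructor <;> linarith
  dsimp only
  generalize hj : ⌊(1 - ‖WeakDual.toStrongDual x‖) / c⌋₊ = j
  obtain ⟨hx1, hx2⟩ := (hfl x hx j).1 hj
  obtain ⟨f, hf, hxf⟩ := exists_re_apply_gt (WeakDual.toStrongDual x) hx2
  have hcont : Continuous fun y : WeakDual 𝕜 E => RCLike.re (y f) :=
    RCLike.continuous_re.comp (WeakDual.eval_continuous f)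
  filter_upwards [hcont.continuousAt.eventually (lt_mem_nhds hxf)] with y hyf hy
  have hle : ∀ (z : WeakDual 𝕜 E) (v : E),
      RCLike.re (z v) ≤ ‖WeakDual.toStrongDual z‖ * ‖v‖ := fun z v =>
    (RCLike.re_le_norm _).trans (ContinuousLinearMap.le_opNorm (WeakDual.toStrongDual z) v)
  have hyn : 1 - (j + 1) * c < ‖WeakDual.toStrongDual y‖ :=
    hyf.trans_le ((hle y f).trans (mul_le_of_le_one_right (norm_nonneg _) hf))
  refine ⟨?_, fun he => ?_⟩
  · refine Nat.lt_succ_iff.1 ((Nat.floor_lt (div_nonneg (by linarith) hc.le)).2 ?_)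
    rw [div_lt_iff₀ hc]
    push_cast
    linarith
  · obtain ⟨hy1, -⟩ := (hfl y hy j).1 he
    suffices h : ‖WeakDual.toStrongDual y - WeakDual.toStrongDual x‖ ≤ ε from fun v =>
      ContinuousLinearMap.le_of_opNorm_le _ h v
    by_contra! hcon
    obtain ⟨g, hg, hgε⟩ := exists_re_apply_gt _ hcon
    have h1 := hle y (f + (t : 𝕜) • g)
    have h2 := hle x (f - (t : 𝕜) • g)
    have e1 : RCLike.re (y (f + (t : 𝕜) • g)) = RCLike.re (y f) + t * RCLike.re (y g) := by
      rw [map_add, map_smul, smul_eq_mul, map_add, RCLike.re_ofReal_mul]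
    have e2 : RCLike.re (x (f - (t : 𝕜) • g)) = RCLike.re (x f) - t * RCLike.re (x g) := by
      rw [map_sub, map_smul, smul_eq_mul, map_sub, RCLike.re_ofReal_mul]
    have e3 : RCLike.re ((WeakDual.toStrongDual y - WeakDual.toStrongDual x) g) =
        RCLike.re (y g) - RCLike.re (x g) := by
      rw [_root_.sub_apply, map_sub]; rfl
    have h3 := hsm f g hf hg
    have htop : 0 ≤ 1 - j * c := (norm_nonneg _).trans hx1
    have h4 : ‖WeakDual.toStrongDual y‖ * ‖f + (t : 𝕜) • g‖ ≤
      (1 - j * c) * ‖f + (t : 𝕜) • g‖ := by gcongr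
    have h5 : ‖WeakDual.toStrongDual x‖ * ‖f - (t : 𝕜) • g‖ ≤
      (1 - j * c) * ‖f - (t : 𝕜) • g‖ := by gcongr
    have h6 : (1 - j * c) * (‖f + (t : 𝕜) • g‖ + ‖f - (t : 𝕜) • g‖) ≤
      (1 - j * c) * (2 + ε / 2 * t) := by gcongr
    have h7 : (1 - j * c) * (ε / 2 * t) ≤ 1 * (ε / 2 * t) := by
      gcongr
      linarith [show 0 ≤ j * c by positivity]
    rw [e3] at hgε
    have h8 : t * ε < t * (RCLike.re (y g) - RCLike.re (x g)) := by gcongr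
    have h9 : RCLike.re ((WeakDual.toStrongDual x) f) = RCLike.re (x f) := rfl
    have h10 : (1 - (j + 1) * c) = (1 - j * c) - t * ε / 4 := by rw [← hcdef]; ring
    linarith

end Smooth

/-! ### Transfinite induction along the rank of a compact set carrying the mass -/

/-- Finitely additive probability-like set functions on `Z`, depending continuously on a point
of `L`. -/
structure MassFamily (L Z : Type*) [TopologicalSpace L] where
  mass : Set Z → L → ℝ
  continuous_mass : ∀ A, Continuous (mass A)
  mass_nonneg : ∀ A x, 0 ≤ mass A x
  mass_le_one : ∀ A x, mass A x ≤ 1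
  mass_union : ∀ A B x, Disjoint A B → mass (A ∪ B) x = mass A x + mass B x

namespace MassFamily

variable {L Z : Type*} [TopologicalSpace L] (M : MassFamily L Z)

theorem mass_mono {A B : Set Z} (h : A ⊆ B) (x : L) : M.mass A x ≤ M.mass B x := by
  have := M.mass_union A (B \ A) x Set.disjoint_sdiff_right
  rw [Set.union_sdiff_cancel h] at this
  linarith [M.mass_nonneg (B \ A) x]

theorem mass_union_le (A B : Set Z) (x : L) : M.mass (A ∪ B) x ≤ M.mass A x + M.mass B x := by
  have := M.mass_union A (B \ A) x Set.disjoint_sdiff_right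
  rw [Set.union_sdiff_self] at this
  linarith [M.mass_mono (Set.sdiff_subset (s := B) (t := A)) x]

variable [TopologicalSpace Z]

/-- The points whose mass lies, up to `τ`, in every neighbourhood of `F`. -/
def nearly (τ : ℝ) (F : Set Z) : Set L :=
  {x | ∀ W, IsOpen W → F ⊆ W → M.mass Wᶜ x ≤ τ}

/-- The mass that `x` puts in arbitrarily small neighbourhoods of `F`. -/
noncomputable def outer (F : Set Z) (x : L) : ℝ :=
  ⨅ U : {U : Set Z // IsOpen U ∧ F ⊆ U}, M.mass U x

theorem outer_le {F U : Set Z} (hU : IsOpen U) (hFU : F ⊆ U) (x : L) :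
    M.outer F x ≤ M.mass U x :=
  ciInf_le (f := fun U : {U : Set Z // IsOpen U ∧ F ⊆ U} => M.mass U x)
    ⟨0, by rintro _ ⟨U, rfl⟩; exact M.mass_nonneg _ _⟩ ⟨U, hU, hFU⟩

theorem outer_nonneg (F : Set Z) (x : L) : 0 ≤ M.outer F x :=
  Real.iInf_nonneg fun _ => M.mass_nonneg _ _

theorem exists_mass_lt_of_outer_lt {F : Set Z} {x : L} {c : ℝ} (h : M.outer F x < c) :
    ∃ U, IsOpen U ∧ F ⊆ U ∧ M.mass U x < c := by
  have : Nonempty {U : Set Z // IsOpen U ∧ F ⊆ U} :=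
    ⟨⟨Set.univ, isOpen_univ, Set.subset_univ F⟩⟩
  obtain ⟨⟨U, hU, hFU⟩, hlt⟩ := exists_lt_of_ciInf_lt h
  exact ⟨U, hU, hFU, hlt⟩

/-- If `x` carries its mass near `F`, and only `c` of it in `U` but away from `F₁ ⊆ U`, then `x`
carries all but `τ + c` of its mass near `F₁ ∪ (F \ U)`. -/
theorem mem_nearly_union_diff {τ c : ℝ} {F F₁ U : Set Z} {x : L} (hx : x ∈ M.nearly τ F)
    (hU : IsOpen U) (hF₁U : F₁ ⊆ U) (hc : M.mass U x ≤ M.outer F₁ x + c) :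
    x ∈ M.nearly (τ + c) (F₁ ∪ F \ U) := by
  intro W hW hFW
  have h1 : M.mass (W ∪ U)ᶜ x ≤ τ := hx _ (hW.union hU) fun z hz => by
    by_cases hzU : z ∈ U
    · exact .inr hzU
    · exact .inl (hFW (.inr ⟨hz, hzU⟩))
  have h2 : M.outer F₁ x ≤ M.mass (W ∩ U) x :=
    M.outer_le (hW.inter hU) (fun z hz => ⟨hFW (.inl hz), hF₁U hz⟩) x
  have h3 := M.mass_union (W ∩ U) (U \ W) x
    (Set.disjoint_left.2 fun z hz hz' => hz'.2 hz.1)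
  have h4 : W ∩ U ∪ U \ W = U := by rw [Set.inter_comm, Set.inter_union_sdiff]
  have h5 : M.mass Wᶜ x ≤ M.mass ((W ∪ U)ᶜ ∪ U \ W) x := M.mass_mono (fun z hz => by
    by_cases hzU : z ∈ U
    · exact .inr ⟨hzU, hz⟩
    · exact .inl fun h => h.elim hz hzU) x
  have h6 := M.mass_union_le (W ∪ U)ᶜ (U \ W) x
  rw [h4] at h3
  linarith

variable [T2Space Z] {dZ : Z → Z → ℝ} {δ : ℝ} {K : Set Z} {d : L → L → ℝ} {c : ℝ → ℝ}

/-- Cutting a neighbourhood of the part `F₁` of large rank out of `F` leaves two disjoint compact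
pieces of rank at most `α * n`. -/
theorem _root_.FragRankLE.exists_split {F : Set Z} (hF : IsCompact F) {α : Ordinal.{u}} {n : ℕ}
    (hn : 1 ≤ n) (h : FragRankLE dZ δ F (α * (n + 1 : ℕ))) :
    ∃ F₁ ⊆ F, IsCompact F₁ ∧
      ∀ U, IsOpen U → F₁ ⊆ U → FragRankLE dZ δ (F₁ ∪ F \ U) (α * n) := by
  obtain ⟨ρ, hρ⟩ := h
  obtain ⟨F₁, hF₁⟩ : ∃ F₁ : Set Z, ∀ x, x ∈ F₁ ↔ x ∈ F ∧ α * n ≤ ρ x := ⟨{x | _}, fun _ => Iff.rfl⟩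
  have hF₁F : F₁ ⊆ F := fun x hx => ((hF₁ x).1 hx).1
  have hcl : IsClosed F₁ := by
    refine isOpen_compl_iff.1 (isOpen_iff_mem_nhds.2 fun x hx => ?_)
    by_cases hxF : x ∈ F
    · have hlt : ρ x < α * n := by
        by_contra! hcon
        exact hx ((hF₁ x).2 ⟨hxF, hcon⟩)
      filter_upwards [eventually_nhdsWithin_iff.1 (hρ x hxF).2] with y hy hcon
      exact (((hF₁ y).1 hcon).2.trans (hy (hF₁F hcon)).1).not_gt hlt
    · filter_upwards [hF.isClosed.isOpen_compl.mem_nhds hxF] with y hy hcon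
      exact hy (hF₁F hcon)
  refine ⟨F₁, hF₁F, hF.of_isClosed_subset hcl hF₁F, fun U hU hFU => ?_⟩
  have hσ : ∀ x ∈ F₁, ∃ σ, ρ x = α * n + σ := fun x hx =>
    exists_add_of_le ((hF₁ x).1 hx).2
  choose! σ hσ using hσ
  classical
  refine ⟨fun x => if x ∈ F₁ then σ x else ρ x, ?_⟩
  rintro a (ha | ⟨haF, haU⟩)
  · simp only [if_pos ha]
    have hlt := (hρ a (hF₁F ha)).1
    rw [hσ a ha, Nat.cast_add, Nat.cast_one, mul_add, mul_one, add_lt_add_iff_left] at hlt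
    refine ⟨hlt.trans_le ?_, ?_⟩
    · calc α = α * (1 : ℕ) := by simp
        _ ≤ α * n := by gcongr
    · filter_upwards [self_mem_nhdsWithin, mem_nhdsWithin_of_mem_nhds (hU.mem_nhds (hFU ha)),
        mem_nhdsWithin_of_mem_nhds (eventually_nhdsWithin_iff.1 (hρ a (hF₁F ha)).2)] with y hy hyU hyρ
      have hy1 : y ∈ F₁ := hy.resolve_right fun h => h.2 hyU
      have := hyρ (hF₁F hy1)
      rw [hσ a ha, hσ y hy1] at this
      simpa only [if_pos hy1, add_le_add_iff_left, add_right_inj] using this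
  · have ha : a ∉ F₁ := fun h => haU (hFU h)
    simp only [if_neg ha]
    refine ⟨lt_of_not_ge fun h => ha ((hF₁ a).2 ⟨haF, h⟩), ?_⟩
    filter_upwards [self_mem_nhdsWithin, mem_nhdsWithin_of_mem_nhds (hcl.isOpen_compl.mem_nhds ha),
      mem_nhdsWithin_of_mem_nhds (eventually_nhdsWithin_iff.1 (hρ a haF).2)] with y hy hy1 hyρ
    simp only [if_neg hy1]
    exact hyρ (hy.resolve_left hy1).1

/-- A bound `β` valid for compact sets of rank at most `α` yields a bound `β * N` for those of rank
at most `α * n`. The mass close to the part of `F` of large rank, rounded down to a multiple of a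
small constant, is an upper semicontinuous function with finitely many values, on whose levels
almost all the mass is carried by a set of smaller rank. -/
theorem exists_fragRankLE_nearly_mul
    (hc : ∀ τ ε, 0 ≤ τ → c τ < ε → ∃ τ' > τ, c τ' < ε) {α β : Ordinal.{u}}
    (hαβ : ∀ F ⊆ K, IsCompact F → FragRankLE dZ δ F α → ∀ τ ε, 0 ≤ τ → c τ < ε →
      FragRankLE d ε (M.nearly τ F) β) {n : ℕ} (hn : 1 ≤ n) :
    ∀ τ ε, 0 ≤ τ → c τ < ε → ∃ N : ℕ, ∀ F ⊆ K, IsCompact F → FragRankLE dZ δ F (α * n) →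
      FragRankLE d ε (M.nearly τ F) (β * N) := by
  induction n, hn using Nat.le_induction with
  | base =>
    intro τ ε hτ hε
    refine ⟨1, fun F hFK hF h => ?_⟩
    simp only [Nat.cast_one, mul_one] at h ⊢
    exact hαβ F hFK hF h τ ε hτ hε
  | succ n hn ih =>
    intro τ ε hτ hε
    obtain ⟨τ', hττ', hτ'⟩ := hc τ ε hτ hε
    obtain ⟨N, hN⟩ := ih τ' ε (hτ.trans hττ'.le) hτ'
    have hr : 0 < τ' - τ := sub_pos.2 hττ'
    refine ⟨N * (⌊1 / (τ' - τ)⌋₊ + 1), fun F hFK hF h => ?_⟩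
    obtain ⟨F₁, hF₁F, hF₁, hsplit⟩ := h.exists_split hF hn
    have hmul : ∀ x, ⌊M.outer F₁ x / (τ' - τ)⌋₊ * (τ' - τ) ≤ M.outer F₁ x ∧
        M.outer F₁ x < (⌊M.outer F₁ x / (τ' - τ)⌋₊ + 1) * (τ' - τ) := fun x =>
      ⟨(le_div_iff₀ hr).1 (Nat.floor_le (div_nonneg (M.outer_nonneg _ _) hr.le)),
        (div_lt_iff₀ hr).1 (Nat.lt_floor_add_one _)⟩
    have hloc : ∀ x, ∃ U, IsOpen U ∧ F₁ ⊆ U ∧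
        M.mass U x < (⌊M.outer F₁ x / (τ' - τ)⌋₊ + 1) * (τ' - τ) := fun x =>
      M.exists_mass_lt_of_outer_lt (hmul x).2
    rw [Ordinal.natCast_mul, ← mul_assoc]
    refine FragRankLE.of_level (Φ := fun x => ⌊M.outer F₁ x / (τ' - τ)⌋₊) (fun x _ => ⟨?_, ?_⟩)
      (fun x _ => ?_)
    · refine Nat.lt_succ_of_le (Nat.floor_mono ?_)
      gcongr
      exact (M.outer_le isOpen_univ (Set.subset_univ _) x).trans (M.mass_le_one _ _)
    · obtain ⟨U, hU, hFU, hlt⟩ := hloc x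
      filter_upwards [mem_nhdsWithin_of_mem_nhds
        ((M.continuous_mass U).continuousAt.eventually (gt_mem_nhds hlt))] with y hy
      refine Nat.lt_succ_iff.1 ((Nat.floor_lt (div_nonneg (M.outer_nonneg _ _) hr.le)).2 ?_)
      rw [div_lt_iff₀ hr]
      push_cast
      exact (M.outer_le hU hFU y).trans_lt hy
    · obtain ⟨U, hU, hFU, hlt⟩ := hloc x
      refine ⟨{y | M.mass U y < (⌊M.outer F₁ x / (τ' - τ)⌋₊ + 1) * (τ' - τ)},
        isOpen_lt (M.continuous_mass U) continuous_const, hlt, ?_⟩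
      have hFU' : F₁ ∪ F \ U ⊆ F := Set.union_subset hF₁F Set.sdiff_subset
      refine (hN (F₁ ∪ F \ U) (hFU'.trans hFK) (hF₁.union (hF.diff hU))
        (hsplit U hU hFU)).mono ?_ le_rfl
      rintro y ⟨⟨hy, hyx⟩, hyU⟩
      have := M.mem_nearly_union_diff (c := τ' - τ) hy hU hFU (by
        have h1 := (hmul y).1
        rw [hyx] at h1
        have h2 : M.mass U y < _ := hyU
        linarith)
      rwa [add_sub_cancel] at this

/-- If the masses carried by sets of rank one have rank at most `ω`, those carried by sets of rank
`ω ^ ξ` have rank at most `ω ^ (1 + ξ)`. -/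
theorem fragRankLE_nearly
    (hc : ∀ τ ε, 0 ≤ τ → c τ < ε → ∃ τ' > τ, c τ' < ε)
    (hone : ∀ F ⊆ K, IsCompact F → FragRankLE dZ δ F (1 : Ordinal.{u}) → ∀ τ ε, 0 ≤ τ → c τ < ε →
      FragRankLE d ε (M.nearly τ F) (ω : Ordinal.{u})) (ξ : Ordinal.{u}) :
    ∀ F ⊆ K, IsCompact F → FragRankLE dZ δ F (ω ^ ξ) → ∀ τ ε, 0 ≤ τ → c τ < ε →
      FragRankLE d ε (M.nearly τ F) (ω ^ (1 + ξ)) := by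
  induction ξ using WellFoundedLT.induction with
  | ind ξ ih =>
    intro F hFK hF h τ ε hτ hε
    rcases eq_or_ne ξ 0 with rfl | hξ
    · simp only [Ordinal.opow_zero, add_zero, Ordinal.opow_one] at h ⊢
      exact hone F hFK hF h τ ε hτ hε
    · obtain ⟨β, hβ, hFβ⟩ := h.exists_lt hF (Ordinal.isSuccLimit_opow_left Ordinal.isSuccLimit_omega0 hξ)
      obtain ⟨η, hη, n, hn⟩ := (Ordinal.lt_omega0_opow hξ).1 hβ
      obtain ⟨N, hN⟩ := M.exists_fragRankLE_nearly_mul hc (ih η hη) (Nat.le_add_left 1 n) τ ε hτ hε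
      have hle : ω ^ η * n ≤ ω ^ η * ((n + 1 : ℕ) : Ordinal.{u}) := by gcongr; simp
      refine (hN F hFK hF (hFβ.mono subset_rfl (hn.le.trans hle))).mono subset_rfl ?_
      calc ω ^ (1 + η) * (N : Ordinal.{u}) ≤ ω ^ (1 + η) * ω := by
            gcongr; exact (Ordinal.natCast_lt_omega0 N).le
        _ = ω ^ (1 + η + 1) := by rw [Ordinal.opow_add ω (1 + η), Ordinal.opow_one]
        _ ≤ ω ^ (1 + ξ) := by
            refine Ordinal.opow_le_opow_right Ordinal.omega0_pos ?_
            rw [add_assoc]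
            gcongr
            exact Order.add_one_le_of_lt hη

end MassFamily

/-! ### Pairings of simple functions with `L_p` functions -/

section Pairing

variable {𝕜 : Type} [RCLike 𝕜] {X : Type u} [NormedAddCommGroup X] {α : Type*}
  [MeasurableSpace α] {μ : Measure α} {p q : ℝ≥0∞}

theorem memLp_simpleFunc_apply [NormedSpace 𝕜 X] [IsFiniteMeasure μ] (g : SimpleFunc α (WeakDual 𝕜 X))
    {f : α → X} (hf : MemLp f p μ) : MemLp (fun t => g t (f t)) p μ :=
  (ContinuousLinearMap.id 𝕜 (StrongDual 𝕜 X)).memLp_of_bilin p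
    ((g.map WeakDual.toStrongDual).memLp_top μ) hf

theorem integrable_simpleFunc_apply_mul [NormedSpace 𝕜 X] [IsFiniteMeasure μ] (hpq : p⁻¹ + q⁻¹ = 1)
    (g : SimpleFunc α (WeakDual 𝕜 X)) (f : Lp X p μ) (h : Lp 𝕜 q μ) :
    Integrable (fun t => g t (f t) * h t) μ := by
  have : ENNReal.HolderTriple p q 1 := ⟨by rw [hpq, inv_one]⟩
  exact (memLp_simpleFunc_apply g (Lp.memLp f)).integrable_mul (Lp.memLp h)

theorem setIntegral_norm_mul_norm_le (hp1 : 1 < p) (hp : p ≠ ∞) (hpq : p⁻¹ + q⁻¹ = 1)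
    (f : Lp X p μ) (h : Lp 𝕜 q μ) (A : Set α) :
    ∫ t in A, ‖f t‖ * ‖h t‖ ∂μ ≤
      ‖f‖ * (∫ t in A, ‖h t‖ ^ q.toReal ∂μ) ^ (1 / q.toReal) := by
  have : Fact (1 ≤ p) := ⟨hp1.le⟩
  have hp0 : p ≠ 0 := (zero_lt_one.trans hp1).ne'
  have hT : ENNReal.HolderTriple p q 1 := ⟨by rw [hpq, inv_one]⟩
  have hq : q ≠ ∞ := by
    rintro rfl
    rw [ENNReal.inv_top, add_zero, ENNReal.inv_eq_one] at hpq
    exact hp1.ne' hpq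
  have hPQ : p.toReal.HolderConjugate q.toReal := by
    rw [Real.holderConjugate_iff]
    refine ⟨?_, ?_⟩
    · rw [← ENNReal.toReal_one]
      exact (ENNReal.toReal_lt_toReal ENNReal.one_ne_top hp).2 hp1
    rw [← ENNReal.toReal_inv, ← ENNReal.toReal_inv, ← ENNReal.toReal_add, hpq, ENNReal.toReal_one]
    · exact ENNReal.inv_ne_top.2 hp0
    · intro hcon
      rw [hcon, add_top] at hpq
      exact ENNReal.top_ne_one hpq
  have key := integral_mul_norm_le_Lp_mul_Lq (μ := μ.restrict A) hPQ (f := fun t => ‖f t‖)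
    (g := fun t => ‖h t‖)
    (by rw [ENNReal.ofReal_toReal hp]; exact ((Lp.memLp f).restrict A).norm)
    (by rw [ENNReal.ofReal_toReal hq]; exact ((Lp.memLp h).restrict A).norm)
  simp only [norm_norm] at key
  refine key.trans (mul_le_mul_of_nonneg_right ?_ (by positivity))
  have h1 : ∫ t in A, ‖f t‖ ^ p.toReal ∂μ ≤ ‖f‖ ^ p.toReal := by
    rw [Lp_norm_rpow_eq_integral hp0 hp]
    exact setIntegral_le_integral ((Lp.memLp f).integrable_norm_rpow hp0 hp)
      (.of_forall fun t => by positivity)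
  calc (∫ t in A, ‖f t‖ ^ p.toReal ∂μ) ^ (1 / p.toReal)
      ≤ (‖f‖ ^ p.toReal) ^ (1 / p.toReal) := by
        have := hPQ.nonneg
        gcongr
    _ = ‖f‖ := by rw [one_div, Real.rpow_rpow_inv (norm_nonneg f) hPQ.ne_zero]

/-- Hölder's inequality for a function bounded by `a * ‖f‖`, except on `A`, where `b * ‖f‖` is
added to the bound. -/
theorem norm_integral_mul_le (hp1 : 1 < p) (hp : p ≠ ∞) (hpq : p⁻¹ + q⁻¹ = 1)
    {f : Lp X p μ} {h : Lp 𝕜 q μ} (hh : ‖h‖ ≤ 1) {A : Set α} (hA : MeasurableSet A) {a b : ℝ}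
    (ha : 0 ≤ a) (hb : 0 ≤ b) {u : α → 𝕜}
    (hu : ∀ᵐ t ∂μ, ‖u t‖ ≤ a * ‖f t‖ + A.indicator (fun t => b * ‖f t‖) t) :
    ‖∫ t, u t * h t ∂μ‖ ≤
      (a + b * (∫ t in A, ‖h t‖ ^ q.toReal ∂μ) ^ (1 / q.toReal)) * ‖f‖ := by
  have hT : ENNReal.HolderTriple p q 1 := ⟨by rw [hpq, inv_one]⟩
  have : Fact (1 ≤ p) := ⟨hp1.le⟩
  have hq1 : Fact (1 ≤ q) := ⟨ENNReal.inv_le_one.1 (hpq ▸ le_add_self)⟩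
  have hq0 : q ≠ 0 := (zero_lt_one.trans_le hq1.out).ne'
  have hq : q ≠ ∞ := by
    rintro rfl
    rw [ENNReal.inv_top, add_zero, ENNReal.inv_eq_one] at hpq
    exact hp1.ne' hpq
  have hint : Integrable (fun t => ‖f t‖ * ‖h t‖) μ :=
    (Lp.memLp f).norm.integrable_mul (Lp.memLp h).norm
  have hI := (hint.const_mul a).add ((hint.const_mul b).indicator hA)
  have h1 := norm_integral_le_of_norm_le hI (f := fun t => u t * h t) (by
    filter_upwards [hu] with t ht
    rw [norm_mul]
    refine (mul_le_mul_of_nonneg_right ht (norm_nonneg _)).trans_eq ?_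
    by_cases htA : t ∈ A <;> simp [htA] <;> ring)
  refine h1.trans ?_
  simp only [Pi.add_apply]
  rw [integral_add (hint.const_mul a) ((hint.const_mul b).indicator hA), integral_indicator hA,
    integral_const_mul, integral_const_mul]
  have h2 := setIntegral_norm_mul_norm_le hp1 hp hpq f h A
  have h3 : ∫ t, ‖f t‖ * ‖h t‖ ∂μ ≤ ‖f‖ := by
    have := setIntegral_norm_mul_norm_le hp1 hp hpq f h Set.univ
    rw [setIntegral_univ, setIntegral_univ, ← Lp_norm_rpow_eq_integral hq0 hq, one_div,
      Real.rpow_rpow_inv (norm_nonneg h) (ENNReal.toReal_pos hq0 hq).ne'] at this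
    exact this.trans (mul_le_of_le_one_right (norm_nonneg f) hh)
  have h4 := mul_le_mul_of_nonneg_left h2 hb
  have h5 := mul_le_mul_of_nonneg_left h3 ha
  linarith

/-- Integration against `h` over `A`, as a functional on the scalar `L_p` space. -/
theorem exists_dual_integral_indicator_mul [Fact (1 ≤ p)] (hp1 : 1 < p) (hp : p ≠ ∞)
    (hpq : p⁻¹ + q⁻¹ = 1) {h : Lp 𝕜 q μ} (hh : ‖h‖ ≤ 1) {A : Set α} (hA : MeasurableSet A) :
    ∃ ψ : WeakDual 𝕜 (Lp 𝕜 p μ), ‖WeakDual.toStrongDual ψ‖ ≤ 1 ∧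
      ∀ f, ψ f = ∫ t, A.indicator f t * h t ∂μ := by
  have hT : ENNReal.HolderTriple p q 1 := ⟨by rw [hpq, inv_one]⟩
  have hint : ∀ f : Lp 𝕜 p μ, Integrable (fun t => A.indicator f t * h t) μ := fun f =>
    ((Lp.memLp f).indicator hA).integrable_mul (Lp.memLp h)
  have hbound : ∀ f : Lp 𝕜 p μ, ‖∫ t, A.indicator f t * h t ∂μ‖ ≤ 1 * ‖f‖ := fun f => by
    have := norm_integral_mul_le hp1 hp hpq (f := f) hh MeasurableSet.empty zero_le_one le_rfl
      (u := A.indicator f) (.of_forall fun t => by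
        simpa using norm_indicator_le_norm_self (f : α → 𝕜) t)
    simpa using this
  refine ⟨StrongDual.toWeakDual (LinearMap.mkContinuous
    { toFun := fun f => ∫ t, A.indicator f t * h t ∂μ, map_add' := ?_, map_smul' := ?_ } 1
    hbound), ?_, fun f => rfl⟩
  · intro f f'
    rw [← integral_add (hint f) (hint f')]
    refine integral_congr_ae ?_
    filter_upwards [Lp.coeFn_add f f'] with t ht
    by_cases htA : t ∈ A
    · simp only [Set.indicator_of_mem htA, ht, Pi.add_apply, add_mul]
    · simp only [Set.indicator_of_notMem htA, zero_mul, add_zero]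
  · intro c f
    rw [RingHom.id_apply, ← integral_smul]
    refine integral_congr_ae ?_
    filter_upwards [Lp.coeFn_smul c f] with t ht
    by_cases htA : t ∈ A
    · simp only [Set.indicator_of_mem htA, ht, Pi.smul_apply, smul_eq_mul, mul_assoc]
    · simp only [Set.indicator_of_notMem htA, zero_mul, smul_zero]
  · exact LinearMap.mkContinuous_norm_le _ zero_le_one hbound

end Pairing

/-! ### Limits along ultrafilters of simple pairs -/

section Pairs

theorem exists_continuous_ultrafilter_limit {S Z : Type*} [TopologicalSpace Z] [T2Space Z]
    {C : Set Z} (hC : IsCompact C) {f : S → Z} (hf : ∀ s, f s ∈ C) :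
    ∃ F : Ultrafilter S → Z, Continuous F ∧ (∀ U, F U ∈ C) ∧
      ∀ U : Ultrafilter S, Filter.Tendsto f U (𝓝 (F U)) := by
  have : CompactSpace C := isCompact_iff_compactSpace.1 hC
  refine ⟨fun U => (Ultrafilter.extend (fun s => (⟨f s, hf s⟩ : C)) U).1,
    continuous_subtype_val.comp (continuous_ultrafilter_extend _), fun U => Subtype.prop _,
    fun U => ?_⟩
  have h : Filter.Tendsto (fun s => (⟨f s, hf s⟩ : C)) U
      (𝓝 (Ultrafilter.extend (fun s => (⟨f s, hf s⟩ : C)) U)) := ultrafilter_extend_eq_iff.1 rfl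
  exact (continuous_subtype_val.tendsto _).comp h

variable {𝕜 : Type} [RCLike 𝕜] {X : Type u} [NormedAddCommGroup X] [NormedSpace 𝕜 X]

/-- An element of `simpleProducts p q K` together with a pair `(g, h)` representing it. -/
structure SimplePair (p q : ℝ≥0∞) [Fact (1 ≤ p)] (K : Set (WeakDual 𝕜 X)) where
  φ : WeakDual 𝕜 (Lp X p (volume : Measure unitInterval))
  g : SimpleFunc unitInterval (WeakDual 𝕜 X)
  h : Lp 𝕜 q (volume : Measure unitInterval)
  g_mem : ∀ t, g t ∈ K
  norm_h_le : ‖h‖ ≤ 1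
  φ_apply : ∀ f : Lp X p (volume : Measure unitInterval), φ f = ∫ t, g t (f t) * h t

variable {p q : ℝ≥0∞} [Fact (1 ≤ p)] {K : Set (WeakDual 𝕜 X)}

theorem range_simplePair_φ :
    Set.range (SimplePair.φ : SimplePair p q K → _) = simpleProducts p q K := by
  ext φ
  constructor
  · rintro ⟨s, rfl⟩
    exact ⟨s.g, s.h, s.g_mem, s.norm_h_le, s.φ_apply⟩
  · rintro ⟨g, h, hg, hh, hφ⟩
    exact ⟨⟨φ, g, h, hg, hh, hφ⟩, rfl⟩

/-- The part of `∫ |h|^q` carried by the set where `g` takes values in `A`. -/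
noncomputable def SimplePair.mass (s : SimplePair p q K) (A : Set (WeakDual 𝕜 X)) : ℝ :=
  ∫ t in s.g ⁻¹' A, ‖s.h t‖ ^ q.toReal

theorem SimplePair.mass_nonneg (s : SimplePair p q K) (A : Set (WeakDual 𝕜 X)) : 0 ≤ s.mass A :=
  integral_nonneg fun t => by positivity

theorem SimplePair.integrable_norm_rpow (s : SimplePair p q K) (hq0 : q ≠ 0) (hq : q ≠ ∞) :
    Integrable (fun t => ‖s.h t‖ ^ q.toReal) :=
  (Lp.memLp s.h).integrable_norm_rpow hq0 hq

theorem exists_massFamily (hq0 : q ≠ 0) (hq : q ≠ ∞) :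
    ∃ M : MassFamily (Ultrafilter (SimplePair p q K)) (WeakDual 𝕜 X),
      ∀ A (U : Ultrafilter (SimplePair p q K)),
        Filter.Tendsto (fun s : SimplePair p q K => s.mass A) U (𝓝 (M.mass A U)) := by
  have hmem : ∀ (A : Set (WeakDual 𝕜 X)) (s : SimplePair p q K), s.mass A ∈ Set.Icc (0 : ℝ) 1 := by
    refine fun A s => ⟨s.mass_nonneg A, ?_⟩
    calc s.mass A ≤ ∫ t, ‖s.h t‖ ^ q.toReal :=
          setIntegral_le_integral (s.integrable_norm_rpow hq0 hq)
            (.of_forall fun t => by positivity)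
      _ = ‖s.h‖ ^ q.toReal := (Lp_norm_rpow_eq_integral hq0 hq s.h).symm
      _ ≤ 1 := Real.rpow_le_one ENNReal.toReal_nonneg s.norm_h_le ENNReal.toReal_nonneg
  choose m hm hm1 hm2 using fun A => exists_continuous_ultrafilter_limit isCompact_Icc (hmem A)
  refine ⟨⟨m, hm, fun A U => (hm1 A U).1, fun A U => (hm1 A U).2, fun A B U hAB => ?_⟩, hm2⟩
  refine tendsto_nhds_unique (hm2 (A ∪ B) U) (((hm2 A U).add (hm2 B U)).congr fun s => ?_)
  have hint := s.integrable_norm_rpow hq0 hq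
  rw [SimplePair.mass, SimplePair.mass, SimplePair.mass, Set.preimage_union,
    setIntegral_union (hAB.preimage _) (s.g.measurableSet_preimage B) hint.integrableOn
      hint.integrableOn]

theorem SimplePair.norm_φ_le (hp1 : 1 < p) (hp : p ≠ ∞) (hpq : p⁻¹ + q⁻¹ = 1) {r : ℝ}
    (hr : 0 ≤ r) (hK : ∀ x ∈ K, ∀ v, ‖x v‖ ≤ r * ‖v‖) (s : SimplePair p q K) :
    ‖WeakDual.toStrongDual s.φ‖ ≤ r := by
  refine ContinuousLinearMap.opNorm_le_bound _ hr fun f => ?_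
  have := norm_integral_mul_le hp1 hp hpq (f := f) s.norm_h_le MeasurableSet.empty hr le_rfl
    (u := fun t => s.g t (f t)) (.of_forall fun t => by simpa using hK _ (s.g_mem t) (f t))
  change ‖s.φ f‖ ≤ _
  rw [s.φ_apply]
  simpa using this

theorem isCompact_lpSet (hp1 : 1 < p) (hp : p ≠ ∞) (hpq : p⁻¹ + q⁻¹ = 1) {r : ℝ}
    (hr : 0 ≤ r) (hK : ∀ x ∈ K, ∀ v, ‖x v‖ ≤ r * ‖v‖) : IsCompact (lpSet p q K) := by
  refine (WeakDual.isCompact_closedBall 0 r).of_isClosed_subset isClosed_closure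
    (closure_minimal ?_ (WeakDual.isClosed_closedBall 0 r))
  rw [← range_simplePair_φ]
  rintro _ ⟨s, rfl⟩
  simpa using s.norm_φ_le hp1 hp hpq hr hK

theorem exists_ultrafilter_param (hC : IsCompact (lpSet p q K)) :
    ∃ π : Ultrafilter (SimplePair p q K) → WeakDual 𝕜 (Lp X p (volume : Measure unitInterval)),
      Continuous π ∧ Set.range π = lpSet p q K ∧
      ∀ U : Ultrafilter (SimplePair p q K), Filter.Tendsto (fun s : SimplePair p q K => s.φ) U (𝓝 (π U)) := by
  have hmem : ∀ s : SimplePair p q K, s.φ ∈ lpSet p q K := fun s =>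
    subset_closure (range_simplePair_φ (p := p) (q := q) (K := K) ▸ Set.mem_range_self s)
  obtain ⟨π, hπ, hπC, hlim⟩ := exists_continuous_ultrafilter_limit hC hmem
  refine ⟨π, hπ, Set.Subset.antisymm (Set.range_subset_iff.2 hπC) ?_, hlim⟩
  refine closure_minimal ?_ (isCompact_range hπ).isClosed
  rw [← range_simplePair_φ]
  rintro _ ⟨s, rfl⟩
  have h : Filter.Tendsto (fun s : SimplePair p q K => s.φ)
      (pure s : Ultrafilter (SimplePair p q K)) (𝓝 s.φ) := by
    rw [Ultrafilter.coe_pure]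
    exact tendsto_pure_nhds _ s
  exact ⟨pure s, tendsto_nhds_unique (hlim _) h⟩

end Pairs

/-! ### Compact sets of rank one -/

section RankOne

variable {𝕜 : Type} [RCLike 𝕜] {X : Type u} [NormedAddCommGroup X] [NormedSpace 𝕜 X]

/-- A compact set of rank one has a finite `δ`-net `T` for the norm, and every point of a
weak-star neighbourhood `O` of the set can be assigned a point of `T` lying in a common
closed set `C a` on which the points of `F` are `δ`-close to `a`. -/
theorem exists_selection {F : Set (WeakDual 𝕜 X)} (hF : IsCompact F) {δ : ℝ} (hδ : 0 ≤ δ)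
    (hone : FragRankLE dualDist δ F (1 : Ordinal.{u})) :
    ∃ (T : Finset (WeakDual 𝕜 X)) (C : WeakDual 𝕜 X → Set (WeakDual 𝕜 X))
      (O : Set (WeakDual 𝕜 X)) (k : WeakDual 𝕜 X → WeakDual 𝕜 X),
      ↑T ⊆ F ∧ (∀ a ∈ T, IsClosed (C a)) ∧
      (∀ a ∈ T, ∀ x ∈ F ∩ C a, ∀ v, ‖x v - a v‖ ≤ δ * ‖v‖) ∧ IsOpen O ∧ F ⊆ O ∧
      (∀ x ∈ O, k x ∈ T ∧ x ∈ C (k x)) ∧ ∀ x ∉ O, k x = 0 := by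
  classical
  obtain ⟨ρ, hρ⟩ := hone
  have hρ0 : ∀ a ∈ F, ρ a = 0 := fun a ha => Order.lt_one_iff.1 (hρ a ha).1
  have hC : ∀ a ∈ F, ∃ C ∈ 𝓝 a, IsClosed C ∧ ∀ x ∈ F ∩ C, ∀ v, ‖x v - a v‖ ≤ δ * ‖v‖ := by
    intro a ha
    obtain ⟨C, ⟨hCa, hCc⟩, hCs⟩ :=
      (closed_nhds_basis a).mem_iff.1 (eventually_nhdsWithin_iff.1 (hρ a ha).2)
    refine ⟨C, hCa, hCc, fun x hx v => ?_⟩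
    have h1 := ((hCs hx.2) hx.1).2 (by rw [hρ0 x hx.1, hρ0 a ha])
    exact (dualDist_le_iff hδ).1 h1 v
  choose! C hCn hCc hCd using hC
  obtain ⟨T, hTF, hcov⟩ := hF.elim_nhds_subcover (fun a => interior (C a))
    fun a ha => interior_mem_nhds.2 (hCn a ha)
  have hk : ∀ x, ∃ a, (x ∈ (⋃ a ∈ T, interior (C a)) → a ∈ T ∧ x ∈ C a) ∧
      (x ∉ (⋃ a ∈ T, interior (C a)) → a = 0) := by
    intro x
    by_cases hx : x ∈ ⋃ a ∈ T, interior (C a)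
    · obtain ⟨a, ha, hxa⟩ := Set.mem_iUnion₂.1 hx
      exact ⟨a, fun _ => ⟨ha, interior_subset hxa⟩, fun h => absurd hx h⟩
    · exact ⟨0, fun h => absurd h hx, fun _ => rfl⟩
  choose k hk1 hk2 using hk
  exact ⟨T, C, _, k, hTF, fun a ha => hCc a (hTF a ha), fun a ha => hCd a (hTF a ha),
    isOpen_biUnion fun a _ => isOpen_interior, hcov, hk1, hk2⟩

variable {p q : ℝ≥0∞} [Fact (1 ≤ p)] {K : Set (WeakDual 𝕜 X)}

/-- Replacing the values `g t` of a simple pair by the nearby points `k (g t)` changes the value at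
a given simple function `f` by little more than `δ * ‖f‖`, up to the contribution of the mass
outside a neighbourhood of `F` depending on `f`. -/
theorem exists_open_norm_φ_sub_le (hp1 : 1 < p) (hp : p ≠ ∞) (hpq : p⁻¹ + q⁻¹ = 1) {r : ℝ}
    (hr : 0 ≤ r) (hK : ∀ x ∈ K, ∀ v, ‖x v‖ ≤ r * ‖v‖) {F : Set (WeakDual 𝕜 X)} (hFK : F ⊆ K)
    {δ δ' : ℝ} (hδ : 0 ≤ δ) (hδ' : δ < δ') {T : Finset (WeakDual 𝕜 X)}
    {C : WeakDual 𝕜 X → Set (WeakDual 𝕜 X)} {O : Set (WeakDual 𝕜 X)}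
    {k : WeakDual 𝕜 X → WeakDual 𝕜 X} (hTF : ↑T ⊆ F) (hC : ∀ a ∈ T, IsClosed (C a))
    (hCd : ∀ a ∈ T, ∀ x ∈ F ∩ C a, ∀ v, ‖x v - a v‖ ≤ δ * ‖v‖) (hO : IsOpen O) (hFO : F ⊆ O)
    (hk : ∀ x ∈ O, k x ∈ T ∧ x ∈ C (k x)) (hk0 : ∀ x ∉ O, k x = 0)
    (f : Lp.simpleFunc X p (volume : Measure unitInterval)) :
    ∃ W, IsOpen W ∧ F ⊆ W ∧ ∀ s : SimplePair p q K,
      ‖s.φ f.1 - ∫ t, s.g.map k t (f.1 t) * s.h t‖ ≤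
        (δ' + 2 * r * s.mass Wᶜ ^ (1 / q.toReal)) * ‖f.1‖ := by
  classical
  have hkr : ∀ x v, ‖k x v‖ ≤ r * ‖v‖ := by
    intro x v
    by_cases hx : x ∈ O
    · exact hK _ (hFK (hTF (hk x hx).1)) v
    · rw [hk0 x hx]
      change ‖(0 : 𝕜)‖ ≤ _
      rw [norm_zero]
      positivity
  have hBcl : IsClosed (⋃ a ∈ T, ⋃ v ∈ (Lp.simpleFunc.toSimpleFunc f).range.erase 0,
      {x | x ∈ C a ∧ δ' * ‖v‖ ≤ ‖x v - a v‖}) := by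
    refine isClosed_biUnion_finset fun a ha => isClosed_biUnion_finset fun v _ => ?_
    have : IsClosed {x : WeakDual 𝕜 X | δ' * ‖v‖ ≤ ‖x v - a v‖} :=
      isClosed_le continuous_const ((WeakDual.eval_continuous v).sub continuous_const).norm
    exact (hC a ha).inter this
  obtain ⟨B, hB, hBdef⟩ : ∃ B, IsClosed B ∧ ∀ x, x ∈ B ↔ ∃ a ∈ T,
      ∃ v ∈ (Lp.simpleFunc.toSimpleFunc f).range.erase 0, x ∈ C a ∧ δ' * ‖v‖ ≤ ‖x v - a v‖ :=
    ⟨_, hBcl, fun x => by simp only [Set.mem_iUnion, exists_prop, Set.mem_ofPred_eq]⟩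
  refine ⟨O \ B, hO.sdiff hB, fun x hx => ⟨hFO hx, fun hxB => ?_⟩, fun s => ?_⟩
  · obtain ⟨a, ha, v, hv, hxa, hle⟩ := (hBdef x).1 hxB
    have hv0 : 0 < ‖v‖ := norm_pos_iff.2 (Finset.ne_of_mem_erase hv)
    have h1 := hCd a ha x ⟨hx, hxa⟩ v
    have h2 : δ * ‖v‖ < δ' * ‖v‖ := by gcongr
    linarith
  · rw [s.φ_apply, ← integral_sub (integrable_simpleFunc_apply_mul hpq s.g _ s.h)
      (integrable_simpleFunc_apply_mul hpq (s.g.map k) _ s.h)]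
    simp only [← sub_mul]
    refine norm_integral_mul_le hp1 hp hpq s.norm_h_le (s.g.measurableSet_preimage _)
      (hδ.trans hδ'.le) (by positivity) ?_
    filter_upwards [Lp.simpleFunc.toSimpleFunc_eq_toFun f] with t ht
    rw [← ht, SimpleFunc.map_apply]
    set v := Lp.simpleFunc.toSimpleFunc f t with hv
    by_cases hW : s.g t ∈ O \ B
    · rw [Set.indicator_of_notMem (fun h : t ∈ s.g ⁻¹' (O \ B)ᶜ => h hW), add_zero]
      rcases eq_or_ne v 0 with h0 | h0
      · simp [h0]
      · by_contra! hcon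
        refine hW.2 ((hBdef _).2 ⟨k (s.g t), (hk _ hW.1).1, v, ?_, (hk _ hW.1).2, hcon.le⟩)
        exact Finset.mem_erase.2 ⟨h0, SimpleFunc.mem_range_self _ t⟩
    · rw [Set.indicator_of_mem (show t ∈ s.g ⁻¹' (O \ B)ᶜ from hW), ← ht]
      have h1 := norm_sub_le (s.g t v) (k (s.g t) v)
      have h2 := hK _ (s.g_mem t) v
      have h3 := hkr (s.g t) v
      have h4 : 0 ≤ δ' * ‖v‖ := mul_nonneg (hδ.trans hδ'.le) (norm_nonneg v)
      linarith

/-- If `k` takes values in the finite set `T`, then the functional with values `k (g t)` splits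
into the parts where `k (g t) = a`, for `a` in `T`. -/
theorem sum_integral_indicator_compLp_mul (hpq : p⁻¹ + q⁻¹ = 1) {T : Finset (WeakDual 𝕜 X)}
    {k : WeakDual 𝕜 X → WeakDual 𝕜 X} (hkT : ∀ x, k x ∈ T) (s : SimplePair p q K)
    (f : Lp X p (volume : Measure unitInterval)) :
    ∑ a ∈ T, ∫ t, (s.g ⁻¹' (k ⁻¹' {a})).indicator ((WeakDual.toStrongDual a).compLp f) t * s.h t =
      ∫ t, s.g.map k t (f t) * s.h t := by
  have hT : ENNReal.HolderTriple p q 1 := ⟨by rw [hpq, inv_one]⟩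
  have hint : ∀ a ∈ T, Integrable (fun t : unitInterval => (s.g ⁻¹' (k ⁻¹' {a})).indicator
      ((WeakDual.toStrongDual a).compLp f) t * s.h t) := fun a _ =>
    ((Lp.memLp ((WeakDual.toStrongDual a).compLp f)).indicator
      (s.g.measurableSet_preimage _)).integrable_mul (Lp.memLp s.h)
  rw [← integral_finsetSum _ hint]
  refine integral_congr_ae ?_
  have hae := (Finset.eventually_all T).2 fun a _ =>
    ContinuousLinearMap.coeFn_compLp (WeakDual.toStrongDual a) f
  filter_upwards [hae] with t ht
  rw [SimpleFunc.map_apply, Finset.sum_eq_single_of_mem _ (hkT (s.g t))]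
  · have hmem : t ∈ s.g ⁻¹' (k ⁻¹' {k (s.g t)}) := rfl
    rw [Set.indicator_of_mem hmem, ht _ (hkT _)]
    rfl
  · intro a _ ha
    have hmem : t ∉ s.g ⁻¹' (k ⁻¹' {a}) := fun h => ha (Eq.symm h)
    rw [Set.indicator_of_notMem hmem, zero_mul]

theorem exists_scalar_parts (hp1 : 1 < p) (hp : p ≠ ∞) (hpq : p⁻¹ + q⁻¹ = 1)
    {T : Finset (WeakDual 𝕜 X)} {k : WeakDual 𝕜 X → WeakDual 𝕜 X} (hkT : ∀ x, k x ∈ T) :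
    ∃ Ψ : WeakDual 𝕜 X → Ultrafilter (SimplePair p q K) →
        WeakDual 𝕜 (Lp 𝕜 p (volume : Measure unitInterval)),
      (∀ a, Continuous (Ψ a)) ∧ (∀ a U, ‖WeakDual.toStrongDual (Ψ a U)‖ ≤ 1) ∧
      ∀ (U : Ultrafilter (SimplePair p q K)) (f : Lp X p (volume : Measure unitInterval)),
        Filter.Tendsto (fun s : SimplePair p q K => ∫ t, s.g.map k t (f t) * s.h t) U
          (𝓝 (∑ a ∈ T, Ψ a U ((WeakDual.toStrongDual a).compLp f))) := by
  have hψ : ∀ (a : WeakDual 𝕜 X) (s : SimplePair p q K),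
      ∃ ψ : WeakDual 𝕜 (Lp 𝕜 p (volume : Measure unitInterval)),
        ‖WeakDual.toStrongDual ψ‖ ≤ 1 ∧
        ∀ f, ψ f = ∫ t, (s.g ⁻¹' (k ⁻¹' {a})).indicator f t * s.h t := fun a s =>
    exists_dual_integral_indicator_mul hp1 hp hpq s.norm_h_le (s.g.measurableSet_preimage _)
  choose ψ hψ1 hψ using hψ
  have hball : ∀ (a : WeakDual 𝕜 X) (s : SimplePair p q K),
      ψ a s ∈ WeakDual.toStrongDual ⁻¹' Metric.closedBall 0 1 := fun a s => by
    simpa using hψ1 a s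
  choose Ψ hΨc hΨ1 hΨ using fun a =>
    exists_continuous_ultrafilter_limit (WeakDual.isCompact_closedBall 0 1) (hball a)
  refine ⟨Ψ, hΨc, fun a U => by simpa using hΨ1 a U, fun U f => ?_⟩
  have h : Filter.Tendsto
      (fun s : SimplePair p q K => ∑ a ∈ T, ψ a s ((WeakDual.toStrongDual a).compLp f)) U
      (𝓝 (∑ a ∈ T, Ψ a U ((WeakDual.toStrongDual a).compLp f))) :=
    tendsto_finsetSum _ fun a _ => ((WeakDual.eval_continuous _).tendsto _).comp (hΨ a U)
  refine h.congr fun s => ?_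
  rw [← sum_integral_indicator_compLp_mul hpq hkT]
  exact Finset.sum_congr rfl fun a _ => hψ a s _

/-- Ultrafilters of simple pairs whose mass lies near a compact set of rank one are described, up to
an error `e`, by finitely many functionals in the unit ball of the dual of the scalar `L_p`
space. -/
theorem exists_scalar_approx (hp1 : 1 < p) (hp : p ≠ ∞) (hpq : p⁻¹ + q⁻¹ = 1) {r : ℝ}
    (hr : 0 ≤ r) (hK : ∀ x ∈ K, ∀ v, ‖x v‖ ≤ r * ‖v‖)
    {M : MassFamily (Ultrafilter (SimplePair p q K)) (WeakDual 𝕜 X)}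
    (hM : ∀ A (U : Ultrafilter (SimplePair p q K)),
      Filter.Tendsto (fun s : SimplePair p q K => s.mass A) U (𝓝 (M.mass A U)))
    {π : Ultrafilter (SimplePair p q K) → WeakDual 𝕜 (Lp X p (volume : Measure unitInterval))}
    (hπ : ∀ U : Ultrafilter (SimplePair p q K),
      Filter.Tendsto (fun s : SimplePair p q K => s.φ) U (𝓝 (π U)))
    {δ : ℝ} (hδ : 0 ≤ δ) {F : Set (WeakDual 𝕜 X)} (hFK : F ⊆ K) (hF : IsCompact F)
    (hone : FragRankLE dualDist δ F (1 : Ordinal.{u})) {τ e : ℝ}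
    (hδe : δ + 2 * r * τ ^ (1 / q.toReal) < e) :
    ∃ (T : Finset (WeakDual 𝕜 X)) (Ψ : WeakDual 𝕜 X → Ultrafilter (SimplePair p q K) →
        WeakDual 𝕜 (Lp 𝕜 p (volume : Measure unitInterval))),
      (∀ a ∈ T, ‖WeakDual.toStrongDual a‖ ≤ r) ∧ (∀ a, Continuous (Ψ a)) ∧
      (∀ a U, ‖WeakDual.toStrongDual (Ψ a U)‖ ≤ 1) ∧
      ∀ U ∈ M.nearly τ F, ∀ f : Lp X p (volume : Measure unitInterval),
        ‖π U f - ∑ a ∈ T, Ψ a U ((WeakDual.toStrongDual a).compLp f)‖ ≤ e * ‖f‖ := by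
  classical
  obtain ⟨T, C, O, k, hTF, hC, hCd, hO, hFO, hk, hk0⟩ := exists_selection hF hδ hone
  have hkT : ∀ x, k x ∈ insert 0 T := fun x => by
    by_cases hx : x ∈ O
    · exact Finset.mem_insert_of_mem (hk x hx).1
    · rw [hk0 x hx]
      exact Finset.mem_insert_self _ _
  obtain ⟨Ψ, hΨc, hΨ1, hΨ⟩ := exists_scalar_parts (K := K) hp1 hp hpq hkT
  refine ⟨insert 0 T, Ψ, fun a ha => ?_, hΨc, hΨ1, fun U hU f => ?_⟩
  · refine ContinuousLinearMap.opNorm_le_bound _ hr fun v => ?_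
    rcases Finset.mem_insert.1 ha with rfl | ha
    · rw [map_zero, _root_.zero_apply, norm_zero]
      positivity
    · exact hK _ (hFK (hTF ha)) v
  have hcl : IsClosed {f : Lp X p (volume : Measure unitInterval) |
      ‖π U f - ∑ a ∈ insert 0 T, Ψ a U ((WeakDual.toStrongDual a).compLp f)‖ ≤ e * ‖f‖} := by
    refine isClosed_le (Continuous.norm (Continuous.sub (map_continuous (π U))
      (continuous_finsetSum _ fun a _ => ?_))) (continuous_const.mul continuous_norm)
    exact (map_continuous (Ψ a U)).comp
      ((WeakDual.toStrongDual a).compLpL p (volume : Measure unitInterval)).continuous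
  refine (Lp.simpleFunc.denseRange hp).induction_on
    (p := fun f => ‖π U f - ∑ a ∈ insert 0 T, Ψ a U ((WeakDual.toStrongDual a).compLp f)‖ ≤
      e * ‖f‖) f hcl fun f => ?_
  obtain ⟨W, hW, hFW, hs⟩ := exists_open_norm_φ_sub_le hp1 hp hpq hr hK hFK hδ
    (δ' := e - 2 * r * τ ^ (1 / q.toReal)) (by linarith) hTF hC hCd hO hFO hk hk0 f
  have hq0 : 0 ≤ 1 / q.toReal := by positivity
  have hlim1 := ((((WeakDual.eval_continuous f.1).tendsto _).comp (hπ U)).sub (hΨ U f.1)).norm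
  have hlim2 := ((((hM Wᶜ U).rpow_const (.inr hq0)).const_mul (2 * r)).const_add
    (e - 2 * r * τ ^ (1 / q.toReal))).mul_const ‖f.1‖
  refine (le_of_tendsto_of_tendsto' hlim1 hlim2 hs).trans ?_
  have h1 : M.mass Wᶜ U ^ (1 / q.toReal) ≤ τ ^ (1 / q.toReal) :=
    Real.rpow_le_rpow (M.mass_nonneg _ _) (hU W hW hFW) hq0
  have h2 : 2 * r * M.mass Wᶜ U ^ (1 / q.toReal) ≤ 2 * r * τ ^ (1 / q.toReal) := by gcongr
  gcongr
  linarith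

/-- Along ultrafilters of simple pairs whose mass lies near a compact set of rank one, the
functional is determined, up to a small error, by finitely many scalar functionals in the unit ball
of the dual of the scalar `L_p` space, where `IsUniformlySmooth.exists_rank` applies. -/
theorem fragRankLE_nearly_one (hp1 : 1 < p) (hp : p ≠ ∞) (hpq : p⁻¹ + q⁻¹ = 1) {r : ℝ}
    (hr : 0 ≤ r) (hK : ∀ x ∈ K, ∀ v, ‖x v‖ ≤ r * ‖v‖)
    {M : MassFamily (Ultrafilter (SimplePair p q K)) (WeakDual 𝕜 X)}
    (hM : ∀ A (U : Ultrafilter (SimplePair p q K)),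
      Filter.Tendsto (fun s : SimplePair p q K => s.mass A) U (𝓝 (M.mass A U)))
    {π : Ultrafilter (SimplePair p q K) → WeakDual 𝕜 (Lp X p (volume : Measure unitInterval))}
    (hπ : ∀ U : Ultrafilter (SimplePair p q K),
      Filter.Tendsto (fun s : SimplePair p q K => s.φ) U (𝓝 (π U)))
    {δ : ℝ} (hδ : 0 ≤ δ) {F : Set (WeakDual 𝕜 X)} (hFK : F ⊆ K) (hF : IsCompact F)
    (hone : FragRankLE dualDist δ F (1 : Ordinal.{u})) {τ ε : ℝ} (hτ : 0 ≤ τ)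
    (hε : 2 * (δ + 2 * r * τ ^ (1 / q.toReal)) < ε) :
    FragRankLE (fun U V => dualDist (π U) (π V)) ε (M.nearly τ F) (ω : Ordinal.{u}) := by
  -- `e` is the error of the approximation, `ε₁` the accuracy required of each scalar part.
  obtain ⟨e, hδe, hee⟩ : ∃ e, δ + 2 * r * τ ^ (1 / q.toReal) < e ∧ 2 * e < ε :=
    ⟨(δ + 2 * r * τ ^ (1 / q.toReal) + ε / 2) / 2, by linarith, by linarith⟩
  obtain ⟨T, Ψ, har, hΨc, hΨ1, happrox⟩ :=
    exists_scalar_approx hp1 hp hpq hr hK hM hπ hδ hFK hF hone hδe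
  obtain ⟨ε₁, hε₁, hε₁e⟩ : ∃ ε₁ > 0, T.card * (ε₁ * r) ≤ ε - 2 * e := by
    refine ⟨(ε - 2 * e) / (T.card * r + 1), div_pos (by linarith) (by positivity), ?_⟩
    rw [div_mul_eq_mul_div, mul_div_assoc', div_le_iff₀ (by positivity)]
    have : 0 ≤ ε - 2 * e := by linarith
    linarith
  obtain ⟨ρ, hρ⟩ := (isUniformlySmooth_Lp (𝕜 := 𝕜) (volume : Measure unitInterval)
    hp1 hp).exists_rank hε₁
  refine ⟨fun U => ((∑ a ∈ T, ρ (Ψ a U) : ℕ) : Ordinal.{u}), fun U hU =>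
    ⟨Ordinal.natCast_lt_omega0 _, ?_⟩⟩
  have hev : ∀ᶠ V in 𝓝 U, ∀ a ∈ T, ρ (Ψ a V) ≤ ρ (Ψ a U) ∧
      (ρ (Ψ a V) = ρ (Ψ a U) → ∀ v, ‖Ψ a V v - Ψ a U v‖ ≤ ε₁ * ‖v‖) := by
    refine (Finset.eventually_all _).2 fun a _ => ?_
    filter_upwards [(hΨc a).continuousAt.eventually (hρ (Ψ a U) (hΨ1 a U))]
      with V hV
    exact hV (hΨ1 a V)
  filter_upwards [mem_nhdsWithin_of_mem_nhds hev, self_mem_nhdsWithin] with V hV hVF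
  refine ⟨by exact_mod_cast Finset.sum_le_sum fun a ha => (hV a ha).1, fun he => ?_⟩
  have heq := (Finset.sum_eq_sum_iff_of_le fun a ha => (hV a ha).1).1 (Nat.cast_injective he)
  rw [dualDist_le_iff (by
    have : 0 ≤ 2 * r * τ ^ (1 / q.toReal) := by positivity
    linarith)]
  intro f
  have h1 := happrox V hVF f
  have h2 := happrox U hU f
  have h3 : ‖∑ a ∈ T, Ψ a V ((WeakDual.toStrongDual a).compLp f) -
      ∑ a ∈ T, Ψ a U ((WeakDual.toStrongDual a).compLp f)‖ ≤
      T.card * (ε₁ * r) * ‖f‖ := by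
    rw [← Finset.sum_sub_distrib, mul_assoc, ← nsmul_eq_mul]
    refine (norm_sum_le _ _).trans (Finset.sum_le_card_nsmul _ _ _ fun a ha => ?_)
    refine ((hV a ha).2 (heq a ha) _).trans ?_
    rw [mul_assoc]
    gcongr
    refine (ContinuousLinearMap.norm_compLp_le _ f).trans ?_
    gcongr
    exact har a ha
  have h4 : T.card * (ε₁ * r) * ‖f‖ ≤ (ε - 2 * e) * ‖f‖ := by gcongr
  have h5 : π V f - π U f =
      (π V f - ∑ a ∈ T, Ψ a V ((WeakDual.toStrongDual a).compLp f)) -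
      (π U f - ∑ a ∈ T, Ψ a U ((WeakDual.toStrongDual a).compLp f)) +
      (∑ a ∈ T, Ψ a V ((WeakDual.toStrongDual a).compLp f) -
        ∑ a ∈ T, Ψ a U ((WeakDual.toStrongDual a).compLp f)) := by ring
  rw [h5]
  refine (norm_add_le _ _).trans ?_
  have h6 := norm_sub_le (π V f - ∑ a ∈ T, Ψ a V ((WeakDual.toStrongDual a).compLp f))
    (π U f - ∑ a ∈ T, Ψ a U ((WeakDual.toStrongDual a).compLp f))
  linarith

end RankOne

/-! ### Bounds for the Szlenk index of `lpSet` -/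

section Main

variable {𝕜 : Type} [RCLike 𝕜] {X : Type u} [NormedAddCommGroup X] [NormedSpace 𝕜 X]
  [CompleteSpace X] {p q : ℝ≥0∞} [Fact (1 ≤ p)] {K : Set (WeakDual 𝕜 X)}

theorem exists_norm_apply_le_of_isCompact (hK : IsCompact K) :
    ∃ r : ℝ, 0 ≤ r ∧ ∀ x ∈ K, ∀ v, ‖x v‖ ≤ r * ‖v‖ := by
  obtain ⟨r, hr⟩ := banach_steinhaus (g := fun x : K => WeakDual.toStrongDual (x : WeakDual 𝕜 X))
    fun v => by
      obtain ⟨C, hC⟩ := (hK.image (WeakDual.eval_continuous v)).isBounded.exists_norm_le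
      exact ⟨C, fun x => hC _ ⟨x, x.2, rfl⟩⟩
  refine ⟨max r 0, le_max_right _ _, fun x hx v => ?_⟩
  exact ContinuousLinearMap.le_of_opNorm_le (WeakDual.toStrongDual x)
    ((hr ⟨x, hx⟩).trans (le_max_left _ _)) v

theorem szlenkIndex_lpSet_le_opow (hp1 : 1 < p) (hp : p ≠ ∞) (hpq : p⁻¹ + q⁻¹ = 1)
    (hK : IsCompact K) {ξ : Ordinal.{u}}
    (h : szlenkIndex K ≤ ((ω ^ ξ : Ordinal.{u}) : WithTop Ordinal.{u})) :
    szlenkIndex (lpSet p q K) ≤ ((ω ^ (1 + ξ) : Ordinal.{u}) : WithTop Ordinal.{u}) := by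
  obtain ⟨r, hr, hKr⟩ := exists_norm_apply_le_of_isCompact hK
  have hq0 : q ≠ 0 := by
    rintro rfl
    simp at hpq
  have hq : q ≠ ∞ := by
    rintro rfl
    rw [ENNReal.inv_top, add_zero, ENNReal.inv_eq_one] at hpq
    exact hp1.ne' hpq
  have hQ : 0 < q.toReal := ENNReal.toReal_pos hq0 hq
  obtain ⟨M, hM⟩ := exists_massFamily (p := p) (K := K) hq0 hq
  obtain ⟨π, hπc, hπr, hπ⟩ := exists_ultrafilter_param (isCompact_lpSet hp1 hp hpq hr hKr)
  rw [szlenkIndex_le_iff] at h ⊢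
  intro ε hε
  have hrank := fragRankLE_of_szlenkIter_eq_empty (by positivity : 0 ≤ ε / 5) hK.isClosed
    (h (ε / 5) (by positivity))
  refine FragRankLE.szlenkIter_eq_empty hε.le ?_
  rw [← hπr]
  refine FragRankLE.range hπc ?_
  have huniv : M.nearly 0 K = Set.univ := by
    refine Set.eq_univ_of_forall fun U W _ hKW => ?_
    refine le_of_tendsto' (hM Wᶜ U) fun s => ?_
    have : s.g ⁻¹' Wᶜ = ∅ := Set.eq_empty_of_forall_notMem fun t ht => ht (hKW (s.g_mem t))
    rw [SimplePair.mass, this, setIntegral_empty]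
  rw [← huniv]
  have hcont : Continuous fun τ : ℝ => 2 * (ε / 5 + 2 * r * τ ^ (1 / q.toReal)) :=
    continuous_const.mul (continuous_const.add (continuous_const.mul
      (Real.continuous_rpow_const (by positivity))))
  refine M.fragRankLE_nearly (K := K) (dZ := dualDist) (δ := ε / 5)
    (c := fun τ => 2 * (ε / 5 + 2 * r * τ ^ (1 / q.toReal))) (fun τ ε' _ hτε => ?_)
    (fun F hFK hF hone τ ε' hτ hτε => ?_) ξ K subset_rfl hK hrank 0 (ε / 2) le_rfl ?_
  · have hev := ((hcont.tendsto τ).eventually (gt_mem_nhds hτε)).filter_mono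
      (nhdsWithin_le_nhds (s := Set.Ioi τ))
    obtain ⟨τ', h1, h2⟩ := (hev.and self_mem_nhdsWithin).exists
    exact ⟨τ', h2, h1⟩
  · exact fragRankLE_nearly_one hp1 hp hpq hr hKr hM hπ (by positivity) hFK hF hone hτ hτε
  · rw [Real.zero_rpow (by positivity)]
    linarith

/-- The map sending `x` to the functional `f ↦ ∫ x (f t) dt = x (∫ f)` embeds `K` into
`lpSet p q K` without shrinking norm distances. -/
theorem szlenkIndex_le_lpSet : szlenkIndex K ≤ szlenkIndex (lpSet p q K) := by
  let _ : NormedSpace ℝ X := NormedSpace.restrictScalars ℝ 𝕜 X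
  have : IsScalarTower ℝ 𝕜 X := .of_algebraMap_smul fun _ _ => rfl
  have hint : ∀ f : Lp X p (volume : Measure unitInterval), Integrable f := fun f =>
    (Lp.memLp f).integrable (Fact.out : 1 ≤ p)
  have hbound : ∀ f : Lp X p (volume : Measure unitInterval), ‖∫ t, f t‖ ≤ 1 * ‖f‖ := by
    intro f
    rw [one_mul, Lp.norm_def]
    refine (norm_integral_le_integral_norm _).trans ?_
    rw [integral_norm_eq_lintegral_enorm (Lp.aestronglyMeasurable f),
      ← eLpNorm_one_eq_lintegral_enorm]
    exact ENNReal.toReal_mono (Lp.eLpNorm_ne_top f)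
      (eLpNorm_le_eLpNorm_of_exponent_le Fact.out (Lp.aestronglyMeasurable f))
  obtain ⟨I, hI⟩ : ∃ I : Lp X p (volume : Measure unitInterval) →L[𝕜] X, ∀ f, I f = ∫ t, f t :=
    ⟨LinearMap.mkContinuous
      { toFun := fun f => ∫ t, f t
        map_add' := fun f g => by
          rw [← integral_add (hint f) (hint g)]
          exact integral_congr_ae (Lp.coeFn_add f g)
        map_smul' := fun c f => by
          rw [RingHom.id_apply, ← integral_smul]
          exact integral_congr_ae (Lp.coeFn_smul c f) } 1 hbound, fun f => rfl⟩
  let J : WeakDual 𝕜 X → WeakDual 𝕜 (Lp X p (volume : Measure unitInterval)) := fun x =>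
    StrongDual.toWeakDual ((WeakDual.toStrongDual x).comp I)
  have hJ : ∀ x f, J x f = x (I f) := fun x f => rfl
  have hJc : Continuous J := WeakDual.continuous_of_continuous_eval fun f => by
    simp only [hJ]
    exact WeakDual.eval_continuous _
  have hJK : Set.MapsTo J K (lpSet p q K) := by
    refine fun x hx => subset_closure ⟨SimpleFunc.const _ x,
      Lp.const q (volume : Measure unitInterval) (1 : 𝕜), fun _ => hx, ?_, fun f => ?_⟩
    · refine (Lp.norm_const_le (p := q) (μ := (volume : Measure unitInterval))
        (c := (1 : 𝕜))).trans ?_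
      simp
    · rw [hJ, hI]
      refine ((WeakDual.toStrongDual x).integral_comp_comm (hint f)).symm.trans
        (integral_congr_ae ?_)
      filter_upwards [Lp.coeFn_const (p := q) (μ := (volume : Measure unitInterval)) (1 : 𝕜)]
        with t ht
      rw [ht, Function.const_apply, mul_one]
      rfl
  have hJd : ∀ x y, 1 * dualDist x y ≤ dualDist (J x) (J y) := by
    intro x y
    rw [one_mul, dualDist_le_iff (dualDist_nonneg _ _)]
    intro v
    have h := norm_sub_apply_le_dualDist (J x) (J y) (Lp.const p (volume : Measure unitInterval) v)
    have hv : I (Lp.const p (volume : Measure unitInterval) v) = v := by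
      rw [hI, integral_congr_ae (Lp.coeFn_const (p := p) (μ := (volume : Measure unitInterval)) v)]
      simp
    rw [hJ, hJ, hv] at h
    refine h.trans (mul_le_mul_of_nonneg_left ?_ (dualDist_nonneg _ _))
    refine (Lp.norm_const_le (p := p) (μ := (volume : Measure unitInterval)) (c := v)).trans ?_
    simp
  rcases eq_or_ne (szlenkIndex (lpSet p q K)) ⊤ with h | h
  · rw [h]
    exact le_top
  · obtain ⟨σ, hσ⟩ := WithTop.ne_top_iff_exists.1 h
    rw [← hσ, szlenkIndex_le_iff]
    intro ε hε
    refine Set.eq_empty_of_forall_notMem fun x hx => ?_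
    have h1 := mapsTo_szlenkIter hJc hJK one_pos hε.le hJd σ hx
    rw [one_mul, szlenkIndex_le_iff.1 hσ.ge ε hε] at h1
    exact h1

end Main

theorem theorem1 {𝕜 : Type} [RCLike 𝕜] {X : Type u} [NormedAddCommGroup X] [NormedSpace 𝕜 X]
    [CompleteSpace X] (p q : ℝ≥0∞) [Fact (1 ≤ p)] (hp1 : 1 < p) (hp : p < ∞)
    (hpq : p⁻¹ + q⁻¹ = 1) (K : Set (WeakDual 𝕜 X)) (hK : IsCompact K) (hne : K.Nonempty) :
    (∀ ξ : Ordinal.{u}, szlenkIndex K ≤ ((ω ^ ξ : Ordinal.{u}) : WithTop Ordinal.{u}) →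
      szlenkIndex (lpSet p q K) ≤ ((ω ^ (1 + ξ) : Ordinal.{u}) : WithTop Ordinal.{u})) ∧
    (Convex ℝ K →
      szlenkIndex (lpSet p q K) ≤ ((ω : Ordinal.{u}) : WithTop Ordinal.{u}) * szlenkIndex K) ∧
    (Convex ℝ K → ((ω ^ (ω : Ordinal.{u}) : Ordinal.{u}) : WithTop Ordinal.{u}) ≤ szlenkIndex K →
      szlenkIndex (lpSet p q K) = szlenkIndex K) := by
  refine ⟨fun ξ h => szlenkIndex_lpSet_le_opow hp1 hp.ne hpq hK h, fun hconv => ?_,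
    fun hconv hω => le_antisymm ?_ szlenkIndex_le_lpSet⟩
  · rcases exists_szlenkIndex_eq_omega0_opow hconv hne with h | ⟨ξ, h⟩
    · rw [h, WithTop.mul_top (by simp [Ordinal.omega0_ne_zero])]
      exact le_top
    · refine (szlenkIndex_lpSet_le_opow hp1 hp.ne hpq hK h.le).trans_eq ?_
      rw [h, ← WithTop.coe_mul, Ordinal.opow_add, Ordinal.opow_one]
  · rcases exists_szlenkIndex_eq_omega0_opow hconv hne with h | ⟨ξ, h⟩
    · rw [h]
      exact le_top
    · have hξ : ω ≤ ξ := by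
        rwa [h, WithTop.coe_le_coe, Ordinal.opow_le_opow_iff_right Ordinal.one_lt_omega0] at hω
      have := szlenkIndex_lpSet_le_opow hp1 hp.ne hpq hK h.le
      rwa [Ordinal.one_add_of_omega0_le hξ, ← h] at this
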